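/- **Setting.** Let $X_1,\dots,X_n$ be i.i.d. random vectors of law $\mathrm P$ on $\mathbb R^d$ with $\mathbb E\|X\|^4<\infty$. Let $G=\mathbb E(XX^\top)$, $\|M\|_F^2=\mathrm{Tr}(M^\top M)$, $s_4^2=\mathbb E(\|X\|^4)^{1/2}$ and $$\kappa=\sup\Bigl\{\frac{\mathbb E\langle\theta,X\rangle^4}{(\mathbb E\langle\theta,X\rangle^2)^2}\ :\ \theta\in\mathbb R^d,\ \mathbb E\langle\theta,X\rangle^2>0\Bigr\}.$$ Let $a>0$, $\epsilon>0$, $\sigma>0$, and let $\Theta_\delta$ be a finite $\delta$-net of the unit sphere $\mathbb S_d$ (a finite subset of $\mathbb S_d$ such that every point of $\mathbb S_d$ is within distance $\delta$ of it). Put $c=\frac{15}{8\log(2)(\sqrt2-1)}\exp\bigl(\frac{1+2\sqrt2}{2}\bigr)$, $K=1+\bigl\lceil a^{-1}\log\bigl(\frac{n}{72(2+c)\kappa^{1/2}}\bigr)\bigr\rceil$, $$\zeta(t)=\sqrt{2(\kappa-1)\Bigl(\frac{(2+3c)s_4^2}{4(2+c)\kappa^{1/2}t}+\log(K/\epsilon)\Bigr)}\cosh(a/4)+\sqrt{\frac{2(2+c)\kappa^{1/2}s_4^2}{t}}\cosh(a/2),$$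 $$B_*(t)=\begin{cases}\dfrac{n^{-1/2}\zeta(\max\{t,\sigma\})}{1-4n^{-1/2}\zeta(\max\{t,\sigma\})} & \text{if } [6+(\kappa-1)^{-1}]\,\zeta(\max\{t,\sigma\})\le\sqrt n,\\ +\infty&\text{otherwise.}\end{cases}$$ **The estimator.** Let $\psi$ be the odd function with $\psi(t)=-\log(1-t+t^2/2)$ for $0\le t\le1$ and $\psi(t)=\log2$ for $t\ge1$, and let $r_\lambda(\theta)=\frac1n\sum_{i=1}^n\psi(\langle\theta,X_i\rangle^2-\lambda)$. For integers $0\le j<K$ put $$\ell_j=\sqrt{\tfrac{2}{n(\kappa-1)}\Bigl(\tfrac{2+3c}{4(2+c)\kappa^{1/2}}e^{ja}+\log(K/\epsilon)\Bigr)},\qquad \beta_j=s_4^2\sqrt{2(2+c)\kappa^{1/2}\,n\,e^{-(j-1/2)a}}.$$ For $\theta\in\mathbb S_d$ the confidence region $C(\theta)$ for $\theta^\top G\theta$ is the set of all $t\ge0$ such that for all $0\le j<K$ and all $\alpha\ge0$, with $N=\alpha^2t$, $$\bigl|r_{\ell_j}(\alpha\theta)-(N-\ell_j)\bigr|\le\frac{(N-\ell_j)^2+(\kappa-1)N^2}{2}+\frac{(2+c)\kappa^{1/2}s_4^2N}{\beta_j}+\frac{(2+3c)s_4^4}{2\beta_j^2}+\frac{\beta_j\alpha^2}{2n}+\frac{\log(K/\epsilon)}{n}.$$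 Let $Q$ be a matrix of least Frobenius norm among the symmetric $d\times d$ matrices with $\theta^\top Q\theta\in C(\theta)$ for all $\theta\in\Theta_\delta$ ($Q=0$ if there is none), and let $\widehat G=Q_+$ be its positive part. Let $\lambda_1\ge\dots\ge\lambda_d$ and $\widehat\lambda_1\ge\dots\ge\widehat\lambda_d$ be the eigenvalues of $G$ and of $\widehat G$, with multiplicity. **Proposition 3.1.** Assume that $8\zeta(\sigma)\le\sqrt n$, $\sigma\le s_4^2$ and $\kappa\ge3/2$. With probability at least $1-2\epsilon$, for every $i=1,\dots,d$, $$\bigl|\max\{\lambda_i,\sigma\}-\max\{\widehat\lambda_i,\sigma\}\bigr|\le2\max\{\lambda_i,\sigma\}B_*(\lambda_i)+5\delta\|G\|_F,$$ $$\bigl|\max\{\lambda_i,\sigma\}-\max\{\widehat\lambda_i,\sigma\}\bigr|\le2\max\{\widehat\lambda_i,\sigma\}B_*\bigl(\min\{\widehat\lambda_i,s_4^2\}\bigr)+5\delta\|G\|_F,$$ and consequently $$|\lambda_i-\widehat\lambda_i|\le2\max\{\lambda_i,\sigma\}B_*(\lambda_i)+5\delta\|G\|_F+\sigma,$$ $$|\lambda_i-\widehat\lambda_i|\le2\max\{\widehat\lambda_i,\sigma\}B_*\bigl(\min\{\widehat\lambda_i,s_4^2\}\bigr)+5\delta\|G\|_F+\sigma.$$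 -/

import Mathlib

open MeasureTheory ProbabilityTheory
open scoped Matrix

noncomputable section

namespace RobustGram

/-! ### Matrices and quadratic forms -/

/-- The quadratic form `θᵀ A θ`. -/
def quadForm {d : ℕ} (A : Matrix (Fin d) (Fin d) ℝ) (θ : EuclideanSpace ℝ (Fin d)) : ℝ :=
  ∑ i, ∑ j, θ i * A i j * θ j

/-- The Frobenius norm `Tr(Aᵀ A)^{1/2}`. -/
def frobenius {d : ℕ} (A : Matrix (Fin d) (Fin d) ℝ) : ℝ :=
  Real.sqrt (Aᵀ * A).trace

/-- The eigenvalues of a symmetric matrix, listed with multiplicity in non-increasing order. -/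
def sortedEigenvalues {d : ℕ} {A : Matrix (Fin d) (Fin d) ℝ} (hA : A.IsHermitian) :
    Fin d → ℝ :=
  fun i => hA.eigenvalues₀ (Fin.cast (Fintype.card_fin d).symm i)

/-! ### The law of the data -/

/-- The Gram matrix `G = E(X Xᵀ)` of a random vector `X` of law `P`. -/
def gram {d : ℕ} (P : Measure (EuclideanSpace ℝ (Fin d))) : Matrix (Fin d) (Fin d) ℝ :=
  Matrix.of fun i j => ∫ x, x i * x j ∂P

theorem gram_isHermitian {d : ℕ} (P : Measure (EuclideanSpace ℝ (Fin d))) :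
    (gram P).IsHermitian := by
  ext i j
  simp [gram, mul_comm]

/-- The kurtosis `κ`: the supremum of `E⟨θ,X⟩⁴ / (E⟨θ,X⟩²)²` over the `θ` for which the
denominator is positive. -/
def kurtosis {d : ℕ} (P : Measure (EuclideanSpace ℝ (Fin d))) : ℝ :=
  sSup {r : ℝ | ∃ θ : EuclideanSpace ℝ (Fin d),
    0 < ∫ x, (inner ℝ θ x) ^ 2 ∂P ∧
      r = (∫ x, (inner ℝ θ x) ^ 4 ∂P) / (∫ x, (inner ℝ θ x) ^ 2 ∂P) ^ 2}

/-- `s₄² = E(‖X‖⁴)^{1/2}`. -/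
def sFourSq {d : ℕ} (P : Measure (EuclideanSpace ℝ (Fin d))) : ℝ :=
  Real.sqrt (∫ x, ‖x‖ ^ 4 ∂P)

/-! ### Constants and the bound -/

/-- The numerical constant `c`. -/
def cst : ℝ :=
  15 / (8 * Real.log 2 * (Real.sqrt 2 - 1)) * Real.exp ((1 + 2 * Real.sqrt 2) / 2)

/-- The number `K` of scales. (Only used when the logarithm below is positive, where the rounding
to natural numbers agrees with the rounding to integers.) -/
def numScales (n : ℕ) (a κ : ℝ) : ℕ :=
  1 + ⌈a⁻¹ * Real.log ((n : ℝ) / (72 * (2 + cst) * Real.sqrt κ))⌉₊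

/-- The function `ζ`. The argument `s2` stands for `s₄²`. -/
def zeta (n : ℕ) (a ε κ s2 t : ℝ) : ℝ :=
  Real.sqrt (2 * (κ - 1) *
      ((2 + 3 * cst) * s2 / (4 * (2 + cst) * Real.sqrt κ * t)
        + Real.log ((numScales n a κ : ℝ) / ε))) * Real.cosh (a / 4)
    + Real.sqrt (2 * (2 + cst) * Real.sqrt κ * s2 / t) * Real.cosh (a / 2)

open Classical in
/-- The function `B_*`, with values in the extended reals. -/
def BStar (n : ℕ) (a ε κ s2 σ t : ℝ) : EReal :=
  if (6 + (κ - 1)⁻¹) * zeta n a ε κ s2 (max t σ) ≤ Real.sqrt n then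
    (((Real.sqrt n)⁻¹ * zeta n a ε κ s2 (max t σ) /
      (1 - 4 * (Real.sqrt n)⁻¹ * zeta n a ε κ s2 (max t σ)) : ℝ) : EReal)
  else ⊤

/-! ### The robust estimator

All the objects of this part are functions of the sample `x` and of known parameters. -/

/-- The odd, non-decreasing, bounded influence function `ψ`: it is `- log (1 - t + t² / 2)`
on `[0, 1]` and `log 2` on `[1, ∞)`. -/
def psi (t : ℝ) : ℝ :=
  if 1 ≤ t then Real.log 2
  else if 0 ≤ t then - Real.log (1 - t + t ^ 2 / 2)
  else if -1 ≤ t then Real.log (1 + t + t ^ 2 / 2)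
  else - Real.log 2

/-- The truncated empirical criterion `r_l(θ) = n⁻¹ ∑ᵢ ψ(⟨θ, xᵢ⟩² - l)`. -/
def criterion {d n : ℕ} (x : Fin n → EuclideanSpace ℝ (Fin d)) (l : ℝ)
    (θ : EuclideanSpace ℝ (Fin d)) : ℝ :=
  (n : ℝ)⁻¹ * ∑ i, psi ((inner ℝ θ (x i)) ^ 2 - l)

/-- The level `λ_j` of the `j`-th scale. -/
def level (n : ℕ) (a ε κ : ℝ) (j : ℕ) : ℝ :=
  Real.sqrt (2 / ((n : ℝ) * (κ - 1)) *
    ((2 + 3 * cst) / (4 * (2 + cst) * Real.sqrt κ) * Real.exp (j * a)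
      + Real.log ((numScales n a κ : ℝ) / ε)))

/-- The inverse variance `β_j` of the Gaussian perturbation at the `j`-th scale. -/
def precision (n : ℕ) (a κ s2 : ℝ) (j : ℕ) : ℝ :=
  s2 * Real.sqrt (2 * (2 + cst) * Real.sqrt κ * n * Real.exp (-((j : ℝ) - 1 / 2) * a))

/-- The width of the PAC-Bayesian deviation bound for `r_l(θ)` around `N - l`, when the quadratic
form at `θ` has the value `N`, with perturbations `N(θ, b⁻¹ I)`. -/
def deviation {d : ℕ} (n : ℕ) (a ε κ s2 l b N : ℝ) (θ : EuclideanSpace ℝ (Fin d)) : ℝ :=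
  ((N - l) ^ 2 + (κ - 1) * N ^ 2) / 2
    + (2 + cst) * Real.sqrt κ * s2 * N / b
    + (2 + 3 * cst) * s2 ^ 2 / (2 * b ^ 2)
    + b * ‖θ‖ ^ 2 / (2 * n)
    + Real.log ((numScales n a κ : ℝ) / ε) / n

/-- The confidence region for the value of the quadratic form `θᵀ G θ`: the values `t ≥ 0` which
the deviation bounds do not exclude, at any scale `j < K` and any point `α θ` of the half-line
spanned by `θ` (where the quadratic form has the value `α² t`). -/
def confidenceRegion {d n : ℕ} (a ε κ s2 : ℝ) (x : Fin n → EuclideanSpace ℝ (Fin d))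
    (θ : EuclideanSpace ℝ (Fin d)) : Set ℝ :=
  {t : ℝ | 0 ≤ t ∧ ∀ j < numScales n a κ, ∀ α : ℝ, 0 ≤ α →
    |criterion x (level n a ε κ j) (α • θ) - (α ^ 2 * t - level n a ε κ j)| ≤
      deviation n a ε κ s2 (level n a ε κ j) (precision n a κ s2 j) (α ^ 2 * t) (α • θ)}

/-- `T` is a finite `δ`-net of the unit sphere. -/
def IsSphereNet {d : ℕ} (δ : ℝ) (T : Finset (EuclideanSpace ℝ (Fin d))) : Prop :=
  (∀ θ ∈ T, ‖θ‖ = 1) ∧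
    ∀ θ : EuclideanSpace ℝ (Fin d), ‖θ‖ = 1 → ∃ ξ ∈ T, ‖θ - ξ‖ ≤ δ

/-- The constraints on the symmetric matrix `Q`: in each direction of the net, its quadratic form
lies in the confidence region. -/
def feasible {d n : ℕ} (a ε κ s2 : ℝ) (T : Finset (EuclideanSpace ℝ (Fin d)))
    (x : Fin n → EuclideanSpace ℝ (Fin d)) : Set (Matrix (Fin d) (Fin d) ℝ) :=
  {Q | Q.IsSymm ∧ ∀ θ ∈ T, quadForm Q θ ∈ confidenceRegion a ε κ s2 x θ}

/-- `Q` has the least Frobenius norm among the matrices satisfying the constraints. -/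
def IsSolution {d n : ℕ} (a ε κ s2 : ℝ) (T : Finset (EuclideanSpace ℝ (Fin d)))
    (x : Fin n → EuclideanSpace ℝ (Fin d)) (Q : Matrix (Fin d) (Fin d) ℝ) : Prop :=
  Q ∈ feasible a ε κ s2 T x ∧ ∀ Q' ∈ feasible a ε κ s2 T x, frobenius Q ≤ frobenius Q'

open Classical in
/-- The symmetric matrix `Q`: a matrix of least Frobenius norm satisfying the constraints
(and `0` if they cannot be satisfied). -/
def estimatorQ {d n : ℕ} (a ε κ s2 : ℝ) (T : Finset (EuclideanSpace ℝ (Fin d)))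
    (x : Fin n → EuclideanSpace ℝ (Fin d)) : Matrix (Fin d) (Fin d) ℝ :=
  if h : ∃ Q, IsSolution a ε κ s2 T x Q then h.choose else 0

/-- The robust estimator `Ĝ = Q₊`, the positive part of `Q`. -/
def estimator {d n : ℕ} (a ε κ s2 : ℝ) (T : Finset (EuclideanSpace ℝ (Fin d)))
    (x : Fin n → EuclideanSpace ℝ (Fin d)) : Matrix (Fin d) (Fin d) ℝ :=
  (estimatorQ a ε κ s2 T x)⁺

theorem estimator_isHermitian {d n : ℕ} (a ε κ s2 : ℝ)
    (T : Finset (EuclideanSpace ℝ (Fin d))) (x : Fin n → EuclideanSpace ℝ (Fin d)) :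
    (estimator a ε κ s2 T x).IsHermitian := by
  unfold estimator
  rw [CFC.posPart_def]
  exact cfcₙ_predicate _ _

end RobustGram

end

noncomputable section

namespace RobustGram

/-! ### The influence function -/

/-! Two facts about the confidence regions carry the proof. With probability at least `1 - 2ε`,
`θᵀGθ` lies in `C(θ)` for all `θ` at once (`exists_deviation_event`). Two points of one region
differ by a relative error of order `n^{-1/2} ζ` (`sub_le_of_mem_confidenceRegion`).

The first fact is a PAC-Bayesian inequality with parameter perturbed by `N(θ, b⁻¹ I)`. Since `ψ(t) ≤
log (1 + t + t²/2)`, one wants to bound `ψ` at the mean by the average of this logarithm over the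
perturbation. The variance of the perturbed square may spoil this, so a nonnegative term, large on
half of the Gaussian mass, is added inside the logarithm; `c ≥ 30` makes it win
(`psi_le_integral_log`). The resulting exponential statistic has expectation at most `1`, and
Cameron–Martin moves the centre to any `θ` at cost `b‖θ‖²/2` (`sum_integral_log_le`), whence
uniformity in `θ`. The second moments left over are controlled by `κ` and `s₄²`.

For the second fact, rescale `θ` so that the larger of the two values becomes the level `l`. The
criterion is the same for both values and cancels, and only the deviation terms remain. At the grid
scale nearest to the optimum they are at most `l n^{-1/2} ζ`; being off the optimum costs the `cosh`
factors.

On the event, `G` is feasible, so `Q` exists and `‖Q‖_F ≤ ‖G‖_F`. Both matrices have forms in the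
same regions on the net, hence close forms there. A Courant–Fischer dimension count passes to
eigenvalues (`abs_max_eigenvalue_sub_le`); the error bound is monotone and grows at rate at most
`1/2`, so the net costs only `5δ‖G‖_F`. Exchanging `G` and `Q` gives the bound in terms of `λ̂ᵢ`,
and taking the positive part is invisible after truncation at `σ > 0`. -/

theorem one_add_add_sq_pos (z : ℝ) : 1 / 2 ≤ 1 + z + z ^ 2 / 2 := by
  nlinarith [sq_nonneg (z + 1)]

theorem psi_neg (t : ℝ) : psi (-t) = - psi t := by
  unfold psi
  split_ifs <;> try linarith
  all_goals first
    | (have : t = 0 := by linarith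
       subst this; simp)
    | (have : t = 1 := by linarith
       subst this; norm_num; rw [one_div, Real.log_inv])
    | (have : t = -1 := by linarith
       subst this; norm_num; rw [one_div, Real.log_inv, neg_neg])
    | (congr 2; ring1)
    | (rw [neg_neg]; congr 1; ring1)

theorem psi_le_log_two (t : ℝ) : psi t ≤ Real.log 2 := by
  have h2 : 0 < Real.log 2 := Real.log_pos (by norm_num)
  unfold psi
  split_ifs with h1 h3 h4
  · exact le_rfl
  · rw [← Real.log_inv]
    apply Real.log_le_log
    · have := one_add_add_sq_pos (-t)
      apply inv_pos.2; nlinarith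
    · rw [inv_le_comm₀ _ (by norm_num)]
      all_goals have := one_add_add_sq_pos (-t); nlinarith
  · apply Real.log_le_log
    · have := one_add_add_sq_pos t; linarith
    · nlinarith
  · linarith

/-- On `[0, 1]` this is `(1 - t + t²/2)(1 + t + t²/2) = 1 + t⁴/4 ≥ 1`; below `-1` it holds because
the polynomial is at least `1/2`. -/
theorem psi_le_log (t : ℝ) : psi t ≤ Real.log (1 + t + t ^ 2 / 2) := by
  have hp := one_add_add_sq_pos t
  unfold psi
  split_ifs with h1 h3 h4
  · exact Real.log_le_log (by norm_num) (by nlinarith)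
  · rw [← Real.log_inv]
    have hq := one_add_add_sq_pos (-t)
    apply Real.log_le_log
    · apply inv_pos.2; nlinarith
    · rw [inv_le_iff_one_le_mul₀ (by nlinarith)]
      nlinarith [pow_nonneg h3 4]
  · exact le_rfl
  · rw [← Real.log_inv]
    exact Real.log_le_log (by norm_num) (by linarith)

/-- A global quadratic lower bound for `log (1 + z + z² / 2)`, tangent at `a`. -/
theorem log_quadratic_lower (a z : ℝ) :
    Real.log (1 + a + a ^ 2 / 2) + (1 + a) / (1 + a + a ^ 2 / 2) * (z - a) - (z - a) ^ 2 / 8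
      ≤ Real.log (1 + z + z ^ 2 / 2) := by
  set s := (1 + a) / (1 + a + a ^ 2 / 2) with hs
  let φ : ℝ → ℝ := fun z => Real.log (1 + z + z ^ 2 / 2) - s * (z - a) + (z - a) ^ 2 / 8
  have hpos : ∀ z : ℝ, 0 < 1 + z + z ^ 2 / 2 := fun z => by linarith [one_add_add_sq_pos z]
  have hd : ∀ z, HasDerivAt φ ((1 + z) / (1 + z + z ^ 2 / 2) - s + (z - a) / 4) z := by
    intro z
    have h1 : HasDerivAt (fun z : ℝ => 1 + z + z ^ 2 / 2) (1 + z) z := by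
      exact (((hasDerivAt_id z).const_add 1).add
        (((hasDerivAt_id z).pow 2).div_const 2)).congr_deriv (by simp)
    have h2 := h1.log (hpos z).ne'
    have h3 := (((hasDerivAt_id z).sub_const a).const_mul s)
    have h4 := (((hasDerivAt_id z).sub_const a).pow 2).div_const 8
    exact ((h2.sub h3).add h4).congr_deriv (by simp; ring)
  -- The second derivative of `log (1 + z + z²/2)` is at least `-1/4`; this is the integrated form,
  -- by an explicit factorisation. Hence `φ` decreases up to `a` and increases after it.
  have key : ∀ z w : ℝ, w ≤ z → 0 ≤ (1 + z) / (1 + z + z ^ 2 / 2)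
      - (1 + w) / (1 + w + w ^ 2 / 2) + (z - w) / 4 := by
    intro z w hwz
    have e : (1 + z) / (1 + z + z ^ 2 / 2) - (1 + w) / (1 + w + w ^ 2 / 2) + (z - w) / 4 =
        (z - w) * ((z * w + z + w - 2) ^ 2 + (z - w) ^ 2) /
          (16 * ((1 + z + z ^ 2 / 2) * (1 + w + w ^ 2 / 2))) := by
      have := (hpos z).ne'; have := (hpos w).ne'
      rw [div_sub_div _ _ (hpos z).ne' (hpos w).ne',
        div_add_div _ _ (mul_pos (hpos z) (hpos w)).ne' (by norm_num),
        div_eq_div_iff (mul_pos (mul_pos (hpos z) (hpos w)) (by norm_num)).ne'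
          (mul_pos (by norm_num) (mul_pos (hpos z) (hpos w))).ne']
      ring
    rw [e]
    exact div_nonneg (mul_nonneg (by linarith) (by positivity))
      (mul_nonneg (by norm_num) (mul_pos (hpos z) (hpos w)).le)
  have hc : Continuous φ := continuous_iff_continuousAt.2 fun z => (hd z).continuousAt
  have hmin : φ a ≤ φ z := by
    rcases le_total a z with h | h
    · refine monotoneOn_of_deriv_nonneg (convex_Ici a) hc.continuousOn
        (fun z _ => (hd z).differentiableAt.differentiableWithinAt) ?_ Set.self_mem_Ici h h
      intro w hw
      replace hw := interior_subset hw
      rw [(hd w).deriv]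
      exact key w a hw
    · refine antitoneOn_of_deriv_nonpos (convex_Iic a) hc.continuousOn
        (fun z _ => (hd z).differentiableAt.differentiableWithinAt) ?_ h Set.self_mem_Iic h
      intro w hw
      replace hw := interior_subset hw
      rw [(hd w).deriv]
      have := key a w hw
      linarith
  simp only [φ] at hmin
  simp at hmin
  linarith

theorem slope_sq_le_one (a : ℝ) : ((1 + a) / (1 + a + a ^ 2 / 2)) ^ 2 ≤ 1 := by
  have hp : 0 < 1 + a + a ^ 2 / 2 := by linarith [one_add_add_sq_pos a]
  rw [div_pow, div_le_one (by positivity)]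
  nlinarith [sq_nonneg (a ^ 2 + 2 * a), sq_nonneg a]

/-- A quadratic minorant of `log (1 + z + z² / 2)` that takes the value `psi a` at `a` and is
bounded above. -/
theorem exists_minorant (a : ℝ) : ∃ s k C : ℝ, 0 < C ∧ 0 ≤ k ∧ 2 * k * (2 * C + 15 / 2) ≤ 30 ∧
    ∀ z, psi a + s * (z - a) - k / 2 * (z - a) ^ 2 ≤ Real.log (1 + z + z ^ 2 / 2) ∧
      psi a + s * (z - a) - k / 2 * (z - a) ^ 2 ≤ Real.log C := by
  rcases lt_or_ge a 1 with ha | ha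
  -- The parabola of `log_quadratic_lower` peaks at `psi a + 2 s² ≤ log 2 + 2 ≤ log 15`, whence `C =
  -- 15`.
  · refine ⟨(1 + a) / (1 + a + a ^ 2 / 2), 1 / 4, 15, by norm_num, by norm_num, by norm_num,
      fun z => ⟨?_, ?_⟩⟩
    · have := log_quadratic_lower a z
      have := psi_le_log a
      linarith
    · have h1 := psi_le_log_two a
      have h2 := slope_sq_le_one a
      set s := (1 + a) / (1 + a + a ^ 2 / 2)
      have h3 : (2 : ℝ) ≤ Real.log (15 / 2) := by
        rw [Real.le_log_iff_exp_le (by norm_num)]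
        have := Real.exp_one_lt_d9
        have e : Real.exp 2 = Real.exp 1 * Real.exp 1 := by rw [← Real.exp_add]; norm_num
        rw [e]
        nlinarith [Real.exp_pos 1]
      have h4 : Real.log 15 = Real.log 2 + Real.log (15 / 2) := by
        rw [← Real.log_mul (by norm_num) (by norm_num)]; norm_num
      nlinarith [sq_nonneg ((z - a) / 2 - 2 * s)]
  · have hpsi : psi a = Real.log 2 := by unfold psi; rw [if_pos ha]
    -- The peak is `log 2 + 1/4`, below both `log 5` and `log 10`. For `z ≤ 2` the parabola is
    -- compared with the minorant tangent at `1`, for `z ≥ 2` with the constant `log 5`.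
    refine ⟨1 / 2, 1 / 2, 10, by norm_num, by norm_num, by norm_num, fun z => ?_⟩
    rw [hpsi]
    have h5 : Real.log (5 / 2) = Real.log 2 + Real.log (5 / 4) := by
      rw [← Real.log_mul (by norm_num) (by norm_num)]; norm_num
    have h6 : (1 / 5 : ℝ) ≤ Real.log (5 / 4) := by
      have := Real.one_sub_inv_le_log_of_pos (show (0 : ℝ) < 5 / 4 by norm_num)
      norm_num at this ⊢; linarith
    have hmax : 1 / 2 * (z - a) - 1 / 2 / 2 * (z - a) ^ 2 ≤ 1 / 4 := by
      nlinarith [sq_nonneg (z - a - 1)]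
    constructor
    · rcases le_total z 2 with hz | hz
      · have h := log_quadratic_lower 1 z
        norm_num at h
        nlinarith [mul_nonneg (sub_nonneg.2 ha) (sub_nonneg.2 hz),
          sq_nonneg (a - 1), sq_nonneg (z - 1 + 6 / 5)]
      · have h8 : Real.log 5 ≤ Real.log (1 + z + z ^ 2 / 2) :=
          Real.log_le_log (by norm_num) (by nlinarith)
        have h9 : Real.log 5 = Real.log 2 + Real.log (5 / 2) := by
          rw [← Real.log_mul (by norm_num) (by norm_num)]; norm_num
        have := Real.one_sub_inv_le_log_of_pos (show (0 : ℝ) < 5 / 2 by norm_num)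
        norm_num at this
        linarith
    · have h9 : Real.log 10 = Real.log 2 + Real.log 5 := by
        rw [← Real.log_mul (by norm_num) (by norm_num)]; norm_num
      have := Real.one_sub_inv_le_log_of_pos (show (0 : ℝ) < 5 by norm_num)
      norm_num at this
      linarith

/-- The only property of the numerical constant that the proof needs; the two factors are bounded
below by `6` and `5`. -/
theorem thirty_le_cst : 30 ≤ cst := by
  unfold cst
  have h2 : Real.sqrt 2 < 1.4143 := by rw [Real.sqrt_lt' (by norm_num)]; norm_num
  have h2' : 1.4142 < Real.sqrt 2 := by rw [Real.lt_sqrt (by norm_num)]; norm_num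
  have hl := Real.log_two_lt_d9
  have hl0 : 0 < Real.log 2 := Real.log_pos (by norm_num)
  have he : (5 : ℝ) ≤ Real.exp ((1 + 2 * Real.sqrt 2) / 2) := by
    have h := Real.sum_le_exp_of_nonneg (show (0 : ℝ) ≤ 19 / 10 by norm_num) 4
    have h' : Real.exp (19 / 10) ≤ Real.exp ((1 + 2 * Real.sqrt 2) / 2) :=
      Real.exp_le_exp.2 (by linarith)
    norm_num [Finset.sum_range_succ, Nat.factorial] at h
    linarith
  have hq : (6 : ℝ) ≤ 15 / (8 * Real.log 2 * (Real.sqrt 2 - 1)) := by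
    rw [le_div_iff₀ (by apply mul_pos <;> linarith)]
    nlinarith
  nlinarith

theorem abs_log_le_of_half_le {y : ℝ} (hy : 1 / 2 ≤ y) : |Real.log y| ≤ y + 1 := by
  have h1 := Real.log_le_sub_one_of_pos (show 0 < y by linarith)
  have h2 : Real.log (1 / 2) ≤ Real.log y := Real.log_le_log (by norm_num) hy
  have h3 : Real.log (1 / 2) = - Real.log 2 := by rw [one_div, Real.log_inv]
  have h4 := Real.log_two_lt_d9
  rw [abs_le]; constructor <;> linarith

theorem integrable_log_of_half_le {Ω : Type*} [MeasurableSpace Ω] {γ : Measure Ω}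
    [IsFiniteMeasure γ] {Y : Ω → ℝ} (hY : Integrable Y γ) (h : ∀ ω, 1 / 2 ≤ Y ω) :
    Integrable (fun ω => Real.log (Y ω)) γ := by
  refine (hY.add (integrable_const (1 : ℝ))).mono' ?_ (.of_forall fun ω => ?_)
  · exact (Real.measurable_log.comp_aemeasurable hY.1.aemeasurable).aestronglyMeasurable
  · exact abs_log_le_of_half_le (h ω)

/-- Lower bound for the expected logarithm of a quadratic polynomial with an added non-negative
perturbation that is large with probability at least `1/2`. -/
theorem psi_le_integral_log {Ω : Type*} [MeasurableSpace Ω] (γ : Measure Ω)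
    [IsProbabilityMeasure γ] {Z S : Ω → ℝ} {z₀ D c : ℝ} (hc : 30 ≤ c)
    (hZ : Integrable Z γ) (hZ2 : Integrable (fun ω => (Z ω - z₀) ^ 2) γ) (hS : Integrable S γ)
    (hmean : ∫ ω, Z ω ∂γ = z₀) (hvar : ∫ ω, (Z ω - z₀) ^ 2 ∂γ = 4 * D) (hS0 : ∀ ω, 0 ≤ S ω)
    {B : Set Ω} (hB : MeasurableSet B) (hBhalf : 1 / 2 ≤ γ.real B)
    (hSB : ∀ ω ∈ B, c * D ≤ S ω) :
    psi z₀ ≤ ∫ ω, Real.log (1 + Z ω + Z ω ^ 2 / 2 + S ω) ∂γ := by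
  have hD : 0 ≤ D := by
    have : 0 ≤ ∫ ω, (Z ω - z₀) ^ 2 ∂γ := integral_nonneg fun ω => sq_nonneg _
    linarith
  have hcD : 0 ≤ c * D := mul_nonneg (by linarith) hD
  have hZsq : Integrable (fun ω => Z ω ^ 2) γ := by
    have : (fun ω => Z ω ^ 2) = fun ω => (Z ω - z₀) ^ 2 + (2 * z₀ * Z ω - z₀ ^ 2) := by
      ext ω; ring
    rw [this]
    exact hZ2.add ((hZ.const_mul _).sub (integrable_const _))
  have hPS : Integrable (fun ω => 1 + Z ω + Z ω ^ 2 / 2 + S ω) γ :=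
    (((integrable_const _).add hZ).add (hZsq.div_const 2)).add hS
  have hhalf : ∀ ω, 1 / 2 ≤ 1 + Z ω + Z ω ^ 2 / 2 + S ω := fun ω => by
    linarith [one_add_add_sq_pos (Z ω), hS0 ω]
  have hlog := integrable_log_of_half_le hPS hhalf
  have hind : ∀ t : ℝ, Integrable (B.indicator fun _ => t) γ := fun t =>
    (integrable_const t).indicator hB
  have hindv : ∀ t : ℝ, ∫ ω, B.indicator (fun _ => t) ω ∂γ = γ.real B * t := fun t => by
    rw [integral_indicator_const _ hB, smul_eq_mul]
  -- If `c D ≤ 15/2`, the gain from `S` beats the variance loss `2 k D`. Otherwise `1 + 2 c D ≥ 16`,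
  -- and half of its logarithm already gives `2 log 2`, enough because `psi ≤ log 2`.
  rcases le_or_gt (c * D) (15 / 2) with hsmall | hlarge
  · obtain ⟨s, k, C, hC, hk, hkC, hh⟩ := exists_minorant z₀
    set t := Real.log (1 + c * D / C) with ht
    have ht0 : 0 ≤ t := Real.log_nonneg (by linarith [div_nonneg hcD hC.le])
    -- For a minorant `h` of `log P`, `log (P + S) ≥ h + log (1 + S / exp h)`, and `exp h ≤ C` makes
    -- the gain independent of `Z`. This is why the minorant must be bounded above.
    have hpt : ∀ ω, (psi z₀ + s * (Z ω - z₀) - k / 2 * (Z ω - z₀) ^ 2) + B.indicator (fun _ => t) ω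
        ≤ Real.log (1 + Z ω + Z ω ^ 2 / 2 + S ω) := by
      intro ω
      obtain ⟨h1, h2⟩ := hh (Z ω)
      set h := psi z₀ + s * (Z ω - z₀) - k / 2 * (Z ω - z₀) ^ 2
      have hP : 0 < 1 + Z ω + Z ω ^ 2 / 2 := by linarith [one_add_add_sq_pos (Z ω)]
      have h3 : Real.exp h ≤ 1 + Z ω + Z ω ^ 2 / 2 := (Real.le_log_iff_exp_le hP).1 h1
      have h4 : Real.exp h ≤ C := (Real.le_log_iff_exp_le hC).1 h2
      have h5 : 1 + S ω / C ≤ 1 + S ω / Real.exp h := by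
        have := div_le_div_of_nonneg_left (hS0 ω) (Real.exp_pos h) h4
        linarith
      have h6 : h + Real.log (1 + S ω / C) ≤ Real.log (1 + Z ω + Z ω ^ 2 / 2 + S ω) := by
        have hSC : 0 ≤ S ω / C := div_nonneg (hS0 ω) hC.le
        calc h + Real.log (1 + S ω / C) ≤ h + Real.log (1 + S ω / Real.exp h) := by
              gcongr
          _ = Real.log (Real.exp h * (1 + S ω / Real.exp h)) := by
              rw [Real.log_mul (Real.exp_pos h).ne' (by linarith), Real.log_exp]
          _ = Real.log (Real.exp h + S ω) := by
              congr 1; field_simp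
          _ ≤ _ := Real.log_le_log (by linarith [Real.exp_pos h, hS0 ω]) (by linarith)
      refine le_trans ?_ h6
      by_cases hω : ω ∈ B
      · rw [Set.indicator_of_mem hω]
        have := hSB ω hω
        gcongr
        rw [ht]
        gcongr
      · rw [Set.indicator_of_notMem hω]
        have := Real.log_nonneg (show 1 ≤ 1 + S ω / C by linarith [div_nonneg (hS0 ω) hC.le])
        linarith
    have hq : Integrable (fun ω => psi z₀ + s * (Z ω - z₀) - k / 2 * (Z ω - z₀) ^ 2) γ :=
      ((integrable_const _).add ((hZ.sub (integrable_const _)).const_mul _)).sub (hZ2.const_mul _)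
    have hmono := integral_mono (hq.add (hind t)) hlog hpt
    refine le_trans ?_ hmono
    rw [integral_add' hq (hind t), hindv, integral_sub, integral_add, integral_const_mul,
      integral_const_mul, integral_sub hZ (integrable_const _), hmean, hvar]
    rotate_left
    · exact integrable_const _
    · exact (hZ.sub (integrable_const _)).const_mul _
    · exact (integrable_const _).add ((hZ.sub (integrable_const _)).const_mul _)
    · exact hZ2.const_mul _
    have h8 := Real.le_log_one_add_of_nonneg (div_nonneg hcD hC.le)
    -- By `log (1 + x) ≥ 2x / (x + 2)` at `x = c D / C`, half the gain is at least `c D / (c D + 2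
    -- C)`. This exceeds `2 k D` because `2 k (2 C + 15/2) ≤ 30 ≤ c`.
    have h9 : 2 * k * D ≤ 1 / 2 * t := by
      have e : 2 * (c * D / C) / (c * D / C + 2) = 2 * (c * D / (c * D + 2 * C)) := by
        field_simp
      rw [e] at h8
      have : 2 * k * D ≤ c * D / (c * D + 2 * C) := by
        rw [le_div_iff₀ (by positivity)]
        have : 2 * k * (c * D + 2 * C) ≤ c := by
          have := mul_le_mul_of_nonneg_left hsmall hk
          linarith
        nlinarith
      linarith
    have h10 : 1 / 2 * t ≤ γ.real B * t := by gcongr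
    simp
    linarith
  · set t := Real.log (1 + 2 * (c * D)) with ht
    have hpt : ∀ ω, - Real.log 2 + B.indicator (fun _ => t) ω
        ≤ Real.log (1 + Z ω + Z ω ^ 2 / 2 + S ω) := by
      intro ω
      have h1 : - Real.log 2 + Real.log (1 + 2 * S ω) ≤
          Real.log (1 + Z ω + Z ω ^ 2 / 2 + S ω) := by
        rw [← Real.log_inv, ← Real.log_mul (by norm_num) (by linarith [hS0 ω])]
        exact Real.log_le_log (by linarith [hS0 ω]) (by linarith [one_add_add_sq_pos (Z ω)])
      refine le_trans ?_ h1
      by_cases hω : ω ∈ B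
      · rw [Set.indicator_of_mem hω]
        have := hSB ω hω
        gcongr
        exact Real.log_le_log (by linarith) (by linarith)
      · rw [Set.indicator_of_notMem hω]
        have := Real.log_nonneg (show 1 ≤ 1 + 2 * S ω by linarith [hS0 ω])
        linarith
    have hmono := integral_mono ((integrable_const (- Real.log 2)).add (hind t)) hlog hpt
    refine le_trans ?_ hmono
    rw [integral_add' (integrable_const _) (hind t), hindv]
    have h1 : 4 * Real.log 2 ≤ t := by
      have : 4 * Real.log 2 = Real.log (2 ^ 4) := by rw [Real.log_pow]; norm_num
      rw [this]
      exact Real.log_le_log (by norm_num) (by linarith)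
    have hl0 : 0 < Real.log 2 := Real.log_pos (by norm_num)
    have := psi_le_log_two z₀
    have h10 : 1 / 2 * t ≤ γ.real B * t := by gcongr; linarith
    simp
    linarith

/-! ### Gaussian moments and Gaussian perturbations -/

open scoped NNReal

theorem integrable_pow_gaussianReal (v : ℝ≥0) (k : ℕ) :
    Integrable (fun y : ℝ => y ^ k) (gaussianReal 0 v) := by
  rcases Nat.eq_zero_or_pos k with rfl | hk
  · simp
  · have := (memLp_id_gaussianReal (μ := 0) (v := v) k).integrable_norm_pow hk.ne'
    refine this.mono' (by fun_prop) (.of_forall fun y => ?_)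
    simp

/-- The moments are the derivatives at `0` of the moment generating function `exp (v t²/2)`, each of
them a polynomial times this exponential. -/
theorem integral_pow_gaussianReal (v : ℝ≥0) :
    ∫ y : ℝ, y ∂(gaussianReal 0 v) = 0 ∧ ∫ y : ℝ, y ^ 2 ∂(gaussianReal 0 v) = v ∧
    ∫ y : ℝ, y ^ 3 ∂(gaussianReal 0 v) = 0 ∧ ∫ y : ℝ, y ^ 4 ∂(gaussianReal 0 v) = 3 * v ^ 2 := by
  have h0 : (0 : ℝ) ∈ interior (integrableExpSet id (gaussianReal 0 v)) := by
    rw [integrableExpSet_id_gaussianReal]; simp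
  have hm := fun n => iteratedDeriv_mgf_zero h0 n
  rw [mgf_id_gaussianReal] at hm
  have he : ∀ t : ℝ, HasDerivAt (fun t : ℝ => Real.exp (0 * t + v * t ^ 2 / 2))
      (v * t * Real.exp (0 * t + v * t ^ 2 / 2)) t := fun t => by
    have h1 := ((hasDerivAt_id t).const_mul (0 : ℝ)).add
      ((((hasDerivAt_id t).pow 2).const_mul (v : ℝ)).div_const 2)
    exact h1.exp.congr_deriv (by simp; ring)
  have hp : ∀ (p : ℝ → ℝ) (p' : ℝ → ℝ), (∀ t, HasDerivAt p (p' t) t) →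
      deriv (fun t => p t * Real.exp (0 * t + v * t ^ 2 / 2)) =
        fun t => (p' t + v * t * p t) * Real.exp (0 * t + v * t ^ 2 / 2) := fun p p' h => by
    ext t
    exact (show HasDerivAt (fun t => p t * Real.exp (0 * t + v * t ^ 2 / 2)) _ t from
      (h t).mul (he t)).deriv.trans (by ring)
  have d1 : iteratedDeriv 1 (fun t : ℝ => Real.exp (0 * t + v * t ^ 2 / 2)) =
      fun t => (v * t) * Real.exp (0 * t + v * t ^ 2 / 2) := by
    rw [iteratedDeriv_one]; ext t; rw [(he t).deriv]
  have d2 : iteratedDeriv 2 (fun t : ℝ => Real.exp (0 * t + v * t ^ 2 / 2)) =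
      fun t => (v + v ^ 2 * t ^ 2) * Real.exp (0 * t + v * t ^ 2 / 2) := by
    rw [iteratedDeriv_succ, d1, hp (fun t => v * t) (fun _ => v)
      (fun t => ((hasDerivAt_id t).const_mul (v : ℝ)).congr_deriv (by simp))]
    ext t; ring
  have d3 : iteratedDeriv 3 (fun t : ℝ => Real.exp (0 * t + v * t ^ 2 / 2)) =
      fun t => (3 * v ^ 2 * t + v ^ 3 * t ^ 3) * Real.exp (0 * t + v * t ^ 2 / 2) := by
    rw [iteratedDeriv_succ, d2, hp (fun t => v + v ^ 2 * t ^ 2) (fun t => v ^ 2 * (2 * t))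
      (fun t => ((((hasDerivAt_id t).pow 2).const_mul ((v : ℝ) ^ 2)).const_add (v : ℝ)).congr_deriv
        (by simp))]
    ext t; ring
  have d4 : iteratedDeriv 4 (fun t : ℝ => Real.exp (0 * t + v * t ^ 2 / 2)) =
      fun t => (3 * v ^ 2 + 6 * v ^ 3 * t ^ 2 + v ^ 4 * t ^ 4) *
        Real.exp (0 * t + v * t ^ 2 / 2) := by
    rw [iteratedDeriv_succ, d3, hp (fun t => 3 * v ^ 2 * t + v ^ 3 * t ^ 3)
      (fun t => 3 * v ^ 2 + v ^ 3 * (3 * t ^ 2))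
      (fun t => (((hasDerivAt_id t).const_mul (3 * (v : ℝ) ^ 2)).add
        (((hasDerivAt_id t).pow 3).const_mul ((v : ℝ) ^ 3))).congr_deriv (by simp))]
    ext t; ring
  have m1 := hm 1; have m2 := hm 2; have m3 := hm 3; have m4 := hm 4
  rw [d1] at m1; rw [d2] at m2; rw [d3] at m3; rw [d4] at m4
  refine ⟨Eq.trans ?_ (m1.symm.trans ?_), Eq.trans ?_ (m2.symm.trans ?_),
    Eq.trans ?_ (m3.symm.trans ?_), Eq.trans ?_ (m4.symm.trans ?_)⟩ <;> simp

/-- Half of the mass of a centered Gaussian lies on either closed side of the origin. -/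
theorem half_le_gaussianReal (v : ℝ≥0) (m : ℝ) :
    1 / 2 ≤ (gaussianReal 0 v).real {y | 0 ≤ m * y} := by
  have hB : MeasurableSet {y : ℝ | 0 ≤ m * y} := measurableSet_le (by fun_prop) (by fun_prop)
  have hsymm : (gaussianReal 0 v).real {y | 0 ≤ m * y} =
      (gaussianReal 0 v).real {y | m * y ≤ 0} := by
    have h := gaussianReal_map_neg (μ := 0) (v := v)
    rw [neg_zero] at h
    conv_lhs => rw [← h]
    rw [measureReal_def, Measure.map_apply (by fun_prop) hB, measureReal_def]
    congr 2
    ext y; simp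
  have hun : {y : ℝ | 0 ≤ m * y} ∪ {y | m * y ≤ 0} = Set.univ := by
    ext y; simpa using le_total 0 (m * y)
  have h1 := measureReal_union_le (μ := gaussianReal 0 v) {y : ℝ | 0 ≤ m * y} {y | m * y ≤ 0}
  rw [hun, ← hsymm, probReal_univ] at h1
  linarith

/-- The polynomial `1 + z + z² / 2`, at `z = ± (w² - v - l)`, with the added perturbation that
makes the expectation of its logarithm dominate the influence function. The sign is `e`. -/
def perturbed (c e l v w : ℝ) : ℝ :=
  1 + e * (w ^ 2 - v - l) + (e * (w ^ 2 - v - l)) ^ 2 / 2 + c * v * (w ^ 2 + v / 2)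

theorem half_le_perturbed {c v : ℝ} (hc : 0 ≤ c) (hv : 0 ≤ v) (e l w : ℝ) :
    1 / 2 ≤ perturbed c e l v w := by
  have := one_add_add_sq_pos (e * (w ^ 2 - v - l))
  have : 0 ≤ c * v * (w ^ 2 + v / 2) := by positivity
  unfold perturbed; linarith

theorem perturbed_expand (c e l v m y : ℝ) (he : e ^ 2 = 1) : perturbed c e l v (m + y) =
    (1 + e * (m ^ 2 - v - l) + (m ^ 2 - v - l) ^ 2 / 2 + c * v * (m ^ 2 + v / 2))
    + (2 * m * e + 2 * m * (m ^ 2 - v - l) + 2 * c * v * m) * y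
    + (e + (m ^ 2 - v - l) + 2 * m ^ 2 + c * v) * y ^ 2 + 2 * m * y ^ 3 + 1 / 2 * y ^ 4 := by
  unfold perturbed
  rw [mul_pow, he]
  ring

theorem integrable_quartic_gaussianReal (v : ℝ≥0) (a₀ a₁ a₂ a₃ a₄ : ℝ) :
    Integrable (fun y : ℝ => a₀ + a₁ * y + a₂ * y ^ 2 + a₃ * y ^ 3 + a₄ * y ^ 4)
      (gaussianReal 0 v) := by
  have h1 : Integrable (fun y : ℝ => y) (gaussianReal 0 v) := by
    simpa using integrable_pow_gaussianReal v 1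
  exact ((((integrable_const _).add (h1.const_mul _)).add
    ((integrable_pow_gaussianReal v 2).const_mul _)).add
    ((integrable_pow_gaussianReal v 3).const_mul _)).add
    ((integrable_pow_gaussianReal v 4).const_mul _)

theorem integral_quartic_gaussianReal (v : ℝ≥0) (a₀ a₁ a₂ a₃ a₄ : ℝ) :
    ∫ y : ℝ, (a₀ + a₁ * y + a₂ * y ^ 2 + a₃ * y ^ 3 + a₄ * y ^ 4) ∂(gaussianReal 0 v) =
      a₀ + a₂ * v + 3 * a₄ * v ^ 2 := by
  have h1 : Integrable (fun y : ℝ => a₁ * y) (gaussianReal 0 v) := by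
    simpa using (integrable_pow_gaussianReal v 1).const_mul a₁
  have h2 := (integrable_pow_gaussianReal v 2).const_mul a₂
  have h3 := (integrable_pow_gaussianReal v 3).const_mul a₃
  have h4 := (integrable_pow_gaussianReal v 4).const_mul a₄
  have h0 : Integrable (fun _ : ℝ => a₀) (gaussianReal 0 v) := integrable_const _
  obtain ⟨m1, m2, m3, m4⟩ := integral_pow_gaussianReal v
  have h01 : Integrable (fun y => a₀ + a₁ * y) (gaussianReal 0 v) := h0.add h1
  have h02 : Integrable (fun y => a₀ + a₁ * y + a₂ * y ^ 2) (gaussianReal 0 v) := h01.add h2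
  have h03 : Integrable (fun y => a₀ + a₁ * y + a₂ * y ^ 2 + a₃ * y ^ 3) (gaussianReal 0 v) :=
    h02.add h3
  rw [integral_add h03 h4, integral_add h02 h3, integral_add h01 h2, integral_add h0 h1,
    integral_const_mul a₁ (fun y => y), m1]
  simp only [integral_const_mul, m2, m3, m4, integral_const, probReal_univ, one_smul]
  ring

/-- Half of the variance `4 v m² + 2 v²` adds to the mean `c v (m² + 3v/2)` of the extra term. This
is the origin of the constants `2 + c` and `2 + 3c`. -/
theorem integral_perturbed (c e l m : ℝ) (v : ℝ≥0) (he : e ^ 2 = 1) :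
    ∫ y : ℝ, perturbed c e l v (m + y) ∂(gaussianReal 0 v) =
      1 + e * (m ^ 2 - l) + (m ^ 2 - l) ^ 2 / 2 + (2 + c) * v * m ^ 2
        + (2 + 3 * c) / 2 * v ^ 2 := by
  simp_rw [fun y => perturbed_expand c e l v m y he]
  rw [integral_quartic_gaussianReal]
  ring

/-- The square `(m + y)²` has mean `m² + v`, hence the centring by `v`, and variance `4 D` with `D =
v m² + v²/2`. On the half-line `m y ≥ 0` it is at least `m²`, so the added term is at least `c D`
there. -/
theorem psi_le_integral_log_perturbed {c e : ℝ} (hc : 30 ≤ c) (he : e ^ 2 = 1) (l m : ℝ)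
    (v : ℝ≥0) :
    psi (e * (m ^ 2 - l)) ≤
      ∫ y : ℝ, Real.log (perturbed c e l v (m + y)) ∂(gaussianReal 0 v) := by
  have hv : (0 : ℝ) ≤ v := v.2
  have eZ : ∀ y : ℝ, e * ((m + y) ^ 2 - v - l) =
      e * (m ^ 2 - v - l) + 2 * m * e * y + e * y ^ 2 + 0 * y ^ 3 + 0 * y ^ 4 := fun y => by ring
  have eZ2 : ∀ y : ℝ, (e * ((m + y) ^ 2 - v - l) - e * (m ^ 2 - l)) ^ 2 =
      v ^ 2 + -(4 * m * v) * y + (4 * m ^ 2 - 2 * v) * y ^ 2 + 4 * m * y ^ 3 + 1 * y ^ 4 :=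
    fun y => by
      rw [← mul_sub, mul_pow, he]; ring
  have eS : ∀ y : ℝ, c * v * ((m + y) ^ 2 + v / 2) =
      c * v * (m ^ 2 + v / 2) + 2 * c * v * m * y + c * v * y ^ 2 + 0 * y ^ 3 + 0 * y ^ 4 :=
    fun y => by ring
  refine psi_le_integral_log (gaussianReal 0 v) (D := v * m ^ 2 + v ^ 2 / 2) hc
    (Z := fun y => e * ((m + y) ^ 2 - v - l)) (S := fun y => c * v * ((m + y) ^ 2 + v / 2))
    ?_ ?_ ?_ ?_ ?_ ?_ (B := {y | 0 ≤ m * y}) ?_ (half_le_gaussianReal v m) ?_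
  · simp_rw [eZ]; exact integrable_quartic_gaussianReal v _ _ _ _ _
  · simp_rw [eZ2]; exact integrable_quartic_gaussianReal v _ _ _ _ _
  · simp_rw [eS]; exact integrable_quartic_gaussianReal v _ _ _ _ _
  · simp_rw [eZ]; rw [integral_quartic_gaussianReal]; ring
  · simp_rw [eZ2]; rw [integral_quartic_gaussianReal]; ring
  · intro y; have : 0 ≤ c := by linarith
    positivity
  · exact measurableSet_le (by fun_prop) (by fun_prop)
  · intro y hy
    have h1 : m ^ 2 ≤ (m + y) ^ 2 := by
      have : 0 ≤ m * y := hy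
      nlinarith [sq_nonneg y]
    have h2 : 0 ≤ c * v := mul_nonneg (by linarith) hv
    nlinarith [mul_le_mul_of_nonneg_left h1 h2]

/-! ### Translations of the standard Gaussian measure -/

open scoped ENNReal

theorem gaussianReal_map_add_eq_withDensity (a : ℝ) :
    (gaussianReal 0 1).map (a + ·) =
      (gaussianReal 0 1).withDensity fun y => ENNReal.ofReal (Real.exp (a * y - a ^ 2 / 2)) := by
  rw [gaussianReal_map_const_add, gaussianReal_of_var_ne_zero _ one_ne_zero,
    gaussianReal_of_var_ne_zero _ one_ne_zero, ← withDensity_mul _ (by fun_prop) (by fun_prop)]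
  congr 1
  ext y
  simp only [Pi.mul_apply, gaussianPDF]
  rw [← ENNReal.ofReal_mul (gaussianPDFReal_nonneg _ _ _)]
  congr 1
  simp only [gaussianPDFReal, zero_add]
  conv_rhs => rw [mul_assoc, ← Real.exp_add]
  congr 2
  simp
  ring

theorem pi_withDensity_prod {ι : Type*} [Fintype ι] (ν : Measure ℝ) [IsProbabilityMeasure ν]
    (h : ι → ℝ → ℝ≥0∞) (hm : ∀ i, Measurable (h i))
    (hone : ∀ i, IsProbabilityMeasure (ν.withDensity (h i))) :
    (Measure.pi fun _ : ι => ν).withDensity (fun x => ∏ i, h i (x i)) =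
      Measure.pi fun i => ν.withDensity (h i) := by
  symm
  apply Measure.pi_eq
  intro s hs
  rw [withDensity_apply _ (MeasurableSet.univ_pi hs),
    ← lintegral_indicator (MeasurableSet.univ_pi hs)]
  have e : ∀ x : ι → ℝ, (Set.univ.pi s).indicator (fun x => ∏ i, h i (x i)) x =
      ∏ i, (s i).indicator (h i) (x i) := by
    intro x
    by_cases hx : x ∈ Set.univ.pi s
    · rw [Set.indicator_of_mem hx]
      refine Finset.prod_congr rfl fun i _ => ?_
      rw [Set.indicator_of_mem (hx i (Set.mem_univ i))]
    · rw [Set.indicator_of_notMem hx]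
      simp only [Set.mem_univ_pi, not_forall] at hx
      obtain ⟨i, hi⟩ := hx
      exact (Finset.prod_eq_zero (Finset.mem_univ i) (Set.indicator_of_notMem hi _)).symm
  simp_rw [e]
  have hm' : ∀ i, Measurable ((s i).indicator (h i)) := fun i => (hm i).indicator (hs i)
  have hind := iIndepFun_pi (μ := fun _ : ι => ν) (X := fun i => (s i).indicator (h i))
    (fun i => (hm' i).aemeasurable)
  rw [lintegral_prod_eq_prod_lintegral_of_indepFun Finset.univ _ hind
    (fun i => (hm' i).comp (measurable_pi_apply i))]
  refine Finset.prod_congr rfl fun i _ => ?_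
  have hev := measurePreserving_eval (fun _ : ι => ν) i
  rw [hev.lintegral_comp (hm' i), lintegral_indicator (hs i), withDensity_apply _ (hs i)]

/-- Cameron–Martin formula, obtained coordinatewise from the one-dimensional densities. -/
theorem lintegral_add_stdGaussian {d : ℕ} (a : EuclideanSpace ℝ (Fin d))
    {f : EuclideanSpace ℝ (Fin d) → ℝ≥0∞} (hf : Measurable f) :
    ∫⁻ u, f (a + u) ∂(stdGaussian (EuclideanSpace ℝ (Fin d))) =
      ∫⁻ u, f u * ENNReal.ofReal (Real.exp (inner ℝ a u - ‖a‖ ^ 2 / 2))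
        ∂(stdGaussian (EuclideanSpace ℝ (Fin d))) := by
  have hshift : (Measure.pi fun _ : Fin d => gaussianReal 0 1).map (fun x i => a i + x i) =
      (Measure.pi fun _ : Fin d => gaussianReal 0 1).withDensity
        (fun x => ∏ i, ENNReal.ofReal (Real.exp (a i * x i - a i ^ 2 / 2))) := by
    have hp : ∀ i : Fin d, IsProbabilityMeasure ((gaussianReal 0 1).withDensity
        fun y => ENNReal.ofReal (Real.exp (a i * y - a i ^ 2 / 2))) := fun i => by
      rw [← gaussianReal_map_add_eq_withDensity]
      exact Measure.isProbabilityMeasure_map (by fun_prop)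
    rw [pi_withDensity_prod (gaussianReal 0 1)
      (fun i y => ENNReal.ofReal (Real.exp (a i * y - a i ^ 2 / 2))) (fun i => by fun_prop) hp]
    simp_rw [← gaussianReal_map_add_eq_withDensity]
    exact Measure.pi_map_pi (hμ := fun i => by
      have := Measure.isProbabilityMeasure_map (μ := gaussianReal 0 1)
        (f := (a i + ·)) (by fun_prop)
      infer_instance) (fun i => by fun_prop)
  have htoLp : Measurable (WithLp.toLp 2 : (Fin d → ℝ) → EuclideanSpace ℝ (Fin d)) := by fun_prop
  have hexp : Measurable fun u : EuclideanSpace ℝ (Fin d) =>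
      ENNReal.ofReal (Real.exp (inner ℝ a u - ‖a‖ ^ 2 / 2)) := by fun_prop
  rw [← map_pi_eq_stdGaussian, lintegral_map (by fun_prop) htoLp,
    lintegral_map (g := WithLp.toLp 2) (f := fun u : EuclideanSpace ℝ (Fin d) =>
      f u * ENNReal.ofReal (Real.exp (inner ℝ a u - ‖a‖ ^ 2 / 2))) (hf.mul hexp) htoLp]
  have hadd : ∀ x : Fin d → ℝ, a + WithLp.toLp 2 x = WithLp.toLp 2 (fun i => a i + x i) :=
    fun x => by ext i; simp
  simp_rw [hadd]
  have h1 := lintegral_map (μ := Measure.pi fun _ : Fin d => gaussianReal 0 1)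
    (f := fun x => f (WithLp.toLp 2 x)) (g := fun x i => a i + x i) (by fun_prop)
    (by fun_prop)
  rw [← h1, hshift, lintegral_withDensity_eq_lintegral_mul _ (by fun_prop) (by fun_prop)]
  refine lintegral_congr fun x => ?_
  rw [Pi.mul_apply, mul_comm]
  congr 1
  rw [← ENNReal.ofReal_prod_of_nonneg (fun i _ => (Real.exp_pos _).le), ← Real.exp_sum]
  congr 2
  rw [Finset.sum_sub_distrib, EuclideanSpace.real_norm_sq_eq, Finset.sum_div]
  congr 1
  simp [PiLp.inner_apply, mul_comm]

/-! ### A PAC-Bayesian deviation inequality -/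

/-- The expectation, under the prior distribution of the parameter, of the exponential statistic
whose expectation with respect to the sample is at most `1`. -/
def pacStat {U S : Type*} [MeasurableSpace U] [MeasurableSpace S] {n : ℕ} (γ : Measure U)
    (P : Measure S) (Φ : U → S → ℝ) (x : Fin n → S) : ℝ≥0∞ :=
  ∫⁻ u, ∏ i, ENNReal.ofReal (Φ u (x i) * Real.exp (1 - ∫ s, Φ u s ∂P)) ∂γ

section PacBayes

variable {U S : Type*} [MeasurableSpace U] [MeasurableSpace S] {n : ℕ} {γ : Measure U}
  {P : Measure S} {Φ : U → S → ℝ}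

theorem measurable_mean [SFinite P] (hΦ : Measurable (Function.uncurry Φ)) :
    Measurable fun u => ∫ s, Φ u s ∂P :=
  (hΦ.stronglyMeasurable.integral_prod_right).measurable

theorem measurable_pacStat_integrand [SFinite P] (hΦ : Measurable (Function.uncurry Φ)) :
    Measurable fun p : (Fin n → S) × U =>
      ∏ i, ENNReal.ofReal (Φ p.2 (p.1 i) * Real.exp (1 - ∫ s, Φ p.2 s ∂P)) := by
  refine Finset.measurable_prod _ fun i _ => ENNReal.measurable_ofReal.comp (Measurable.mul ?_ ?_)
  · exact hΦ.comp (measurable_snd.prodMk ((measurable_pi_apply i).comp measurable_fst))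
  · exact Real.measurable_exp.comp (((measurable_mean hΦ).comp measurable_snd).const_sub 1)

theorem measurable_pacStat [SFinite γ] [SFinite P] (hΦ : Measurable (Function.uncurry Φ)) :
    Measurable fun x : Fin n → S => pacStat γ P Φ x :=
  (measurable_pacStat_integrand hΦ).lintegral_prod_right

/-- After Fubini and independence, each factor has expectation `M exp (1 - M) ≤ 1`, where `M` is the
mean of `Φ u`. Normalising by `exp (1 - M)` instead of `M⁻¹` keeps the final bound linear in `M`. -/
theorem lintegral_pacStat_le_one {Ω : Type*} [MeasurableSpace Ω] {μ : Measure Ω}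
    [IsProbabilityMeasure μ] [IsProbabilityMeasure γ] [IsProbabilityMeasure P]
    (hΦ : Measurable (Function.uncurry Φ)) (hpos : ∀ u s, 0 ≤ Φ u s)
    (hint : ∀ u, Integrable (Φ u) P) {X : Fin n → Ω → S} (hX : ∀ i, Measurable (X i))
    (hindep : iIndepFun X μ) (hlaw : ∀ i, μ.map (X i) = P) :
    ∫⁻ ω, pacStat γ P Φ (fun i => X i ω) ∂μ ≤ 1 := by
  unfold pacStat
  rw [lintegral_lintegral_swap]
  · calc _ ≤ ∫⁻ _, 1 ∂γ := lintegral_mono fun u => ?_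
      _ = 1 := by simp
    have hm : Measurable fun s => ENNReal.ofReal (Φ u s * Real.exp (1 - ∫ s, Φ u s ∂P)) :=
      ENNReal.measurable_ofReal.comp ((hΦ.comp measurable_prodMk_left).mul_const _)
    have hc := hindep.comp (fun _ s => ENNReal.ofReal (Φ u s * Real.exp (1 - ∫ s, Φ u s ∂P)))
      (fun _ => hm)
    have := lintegral_prod_eq_prod_lintegral_of_indepFun Finset.univ _ hc
      (fun i => hm.comp (hX i))
    simp only [Function.comp_def] at this
    rw [this]
    refine Finset.prod_le_one' fun i _ => ?_
    rw [← lintegral_map hm (hX i), hlaw i, ← ofReal_integral_eq_lintegral_ofReal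
      ((hint u).mul_const _) (.of_forall fun s => mul_nonneg (hpos u s) (Real.exp_pos _).le),
      integral_mul_const, ENNReal.ofReal_le_one]
    set M := ∫ s, Φ u s ∂P
    have h1 : M ≤ Real.exp (M - 1) := by linarith [Real.add_one_le_exp (M - 1)]
    calc M * Real.exp (1 - M) ≤ Real.exp (M - 1) * Real.exp (1 - M) := by gcongr
      _ = 1 := by rw [← Real.exp_add]; simp
  · have hXm : Measurable fun ω i => X i ω := measurable_pi_lambda _ hX
    exact ((measurable_pacStat_integrand hΦ).comp
      ((hXm.comp measurable_fst).prodMk measurable_snd)).aemeasurable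

theorem measure_pacStat_gt_le {Ω : Type*} [MeasurableSpace Ω] {μ : Measure Ω}
    [IsProbabilityMeasure μ] [IsProbabilityMeasure γ] [IsProbabilityMeasure P]
    (hΦ : Measurable (Function.uncurry Φ)) (hpos : ∀ u s, 0 ≤ Φ u s)
    (hint : ∀ u, Integrable (Φ u) P) {X : Fin n → Ω → S} (hX : ∀ i, Measurable (X i))
    (hindep : iIndepFun X μ) (hlaw : ∀ i, μ.map (X i) = P) {η : ℝ} (hη : 0 < η) :
    μ.real {ω | ENNReal.ofReal η⁻¹ < pacStat γ P Φ (fun i => X i ω)} ≤ η := by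
  have hXm : Measurable fun ω i => X i ω := measurable_pi_lambda _ hX
  have h1 := lintegral_pacStat_le_one (γ := γ) hΦ hpos hint hX hindep hlaw
  have hη' : ENNReal.ofReal η⁻¹ ≠ 0 := by simpa using hη
  have h2 := meas_ge_le_lintegral_div (μ := μ)
    ((measurable_pacStat (γ := γ) (P := P) hΦ).comp hXm).aemeasurable hη' ENNReal.ofReal_ne_top
  have h3 : μ {ω | ENNReal.ofReal η⁻¹ < pacStat γ P Φ (fun i => X i ω)} ≤ ENNReal.ofReal η := by
    calc μ {ω | ENNReal.ofReal η⁻¹ < pacStat γ P Φ (fun i => X i ω)}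
        ≤ μ {ω | ENNReal.ofReal η⁻¹ ≤ pacStat γ P Φ (fun i => X i ω)} :=
          measure_mono (Set.ofPred_subset_ofPred.2 fun ω hω => hω.le)
      _ ≤ _ := h2
      _ ≤ 1 / ENNReal.ofReal η⁻¹ := ENNReal.div_le_div_right h1 _
      _ = ENNReal.ofReal η := by
        rw [ENNReal.ofReal_inv_of_pos hη, one_div, inv_inv]
  exact ENNReal.toReal_le_of_le_ofReal hη.le h3

end PacBayes

/-- The PAC-Bayesian inequality for translations of the standard Gaussian measure. -/
theorem sum_integral_log_le {d n : ℕ} {S : Type*} [MeasurableSpace S] {P : Measure S} [SFinite P]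
    {Φ : EuclideanSpace ℝ (Fin d) → S → ℝ} (hΦ : Measurable (Function.uncurry Φ))
    (hpos : ∀ u s, 0 < Φ u s) (x : Fin n → S) {η : ℝ} (hη : 0 < η)
    (hx : pacStat (stdGaussian (EuclideanSpace ℝ (Fin d))) P Φ x ≤ ENNReal.ofReal η⁻¹)
    (a : EuclideanSpace ℝ (Fin d))
    (hlog : ∀ i, Integrable (fun u => Real.log (Φ (a + u) (x i)))
      (stdGaussian (EuclideanSpace ℝ (Fin d))))
    (hmean : Integrable (fun u => ∫ s, Φ (a + u) s ∂P)
      (stdGaussian (EuclideanSpace ℝ (Fin d)))) :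
    ∑ i, ∫ u, Real.log (Φ (a + u) (x i)) ∂(stdGaussian (EuclideanSpace ℝ (Fin d))) ≤
      n * (∫ u, ∫ s, Φ (a + u) s ∂P ∂(stdGaussian (EuclideanSpace ℝ (Fin d))) - 1)
        + ‖a‖ ^ 2 / 2 + Real.log η⁻¹ := by
  set γ := stdGaussian (EuclideanSpace ℝ (Fin d))
  set M : EuclideanSpace ℝ (Fin d) → ℝ := fun u => ∫ s, Φ u s ∂P with hM
  have hinner : Integrable (fun u => inner ℝ a u) γ := by
    have := (IsGaussian.integrable_id (μ := γ))
    exact this.const_inner a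
  have hinner0 : ∫ u, inner ℝ a u ∂γ = 0 := integral_strongDual_stdGaussian (innerSL ℝ a)
  -- The log-density of the translated Gaussian at `a + u` is `⟨a, u⟩ + ‖a‖²/2`. Subtracting it
  -- makes `exp Y` integrate to `η` times `pacStat`, and its mean `‖a‖²/2` is the price of the
  -- translation.
  let Y : EuclideanSpace ℝ (Fin d) → ℝ := fun u =>
    (∑ i, Real.log (Φ (a + u) (x i)) - n * (M (a + u) - 1)) - inner ℝ a u
      - (‖a‖ ^ 2 / 2 + Real.log η⁻¹)
  have hsum : Integrable (fun u => ∑ i, Real.log (Φ (a + u) (x i))) γ :=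
    integrable_finsetSum _ fun i _ => hlog i
  have hM1 : Integrable (fun u => n * (M (a + u) - 1)) γ :=
    (hmean.sub (integrable_const 1)).const_mul _
  have hY : Integrable Y γ := ((hsum.sub hM1).sub hinner).sub (integrable_const _)
  have hY0 : ∫ u, Y u ∂γ = ∑ i, ∫ u, Real.log (Φ (a + u) (x i)) ∂γ
      - n * (∫ u, M (a + u) ∂γ - 1) - (‖a‖ ^ 2 / 2 + Real.log η⁻¹) := by
    have i1 : Integrable (fun u => ∑ i, Real.log (Φ (a + u) (x i)) - n * (M (a + u) - 1)) γ :=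
      hsum.sub hM1
    have i2 : Integrable (fun u => ∑ i, Real.log (Φ (a + u) (x i)) - n * (M (a + u) - 1)
      - inner ℝ a u) γ := i1.sub hinner
    simp only [Y]
    rw [integral_sub i2 (integrable_const _), integral_sub i1 hinner, integral_sub hsum hM1,
      integral_finsetSum _ fun i _ => hlog i, integral_const_mul,
      integral_sub hmean (integrable_const 1), hinner0]
    simp [M]
  have hexp : ∫⁻ u, ENNReal.ofReal (Real.exp (Y u)) ∂γ ≤ 1 := by
    have hmeas : Measurable fun u => ∏ i, ENNReal.ofReal (Φ u (x i) * Real.exp (1 - M u)) :=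
      (measurable_pacStat_integrand (P := P) hΦ).comp (measurable_prodMk_left (x := x))
    have hw : Measurable fun u : EuclideanSpace ℝ (Fin d) =>
        ENNReal.ofReal (Real.exp (-(inner ℝ a u - ‖a‖ ^ 2 / 2))) := by fun_prop
    have key := lintegral_add_stdGaussian a (hmeas.mul hw)
    have hl : ∀ u, ENNReal.ofReal (Real.exp (Y u)) = ENNReal.ofReal η *
        ((∏ i, ENNReal.ofReal (Φ (a + u) (x i) * Real.exp (1 - M (a + u)))) *
          ENNReal.ofReal (Real.exp (-(inner ℝ a (a + u) - ‖a‖ ^ 2 / 2)))) := by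
      intro u
      rw [← ENNReal.ofReal_prod_of_nonneg
          (fun i _ => mul_nonneg (hpos _ _).le (Real.exp_pos _).le),
        ← ENNReal.ofReal_mul (Finset.prod_nonneg
          (fun i _ => mul_nonneg (hpos _ _).le (Real.exp_pos _).le)), ← ENNReal.ofReal_mul hη.le]
      congr 1
      have e1 : ∀ i, Φ (a + u) (x i) * Real.exp (1 - M (a + u)) =
          Real.exp (Real.log (Φ (a + u) (x i)) + (1 - M (a + u))) := fun i => by
        rw [Real.exp_add, Real.exp_log (hpos _ _)]
      simp_rw [e1]
      rw [← Real.exp_sum, ← Real.exp_add]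
      conv_rhs => rw [← Real.exp_log hη, ← Real.exp_add]
      congr 1
      simp only [Y, Real.log_inv, inner_add_right, real_inner_self_eq_norm_sq,
        Finset.sum_add_distrib, Finset.sum_const, Finset.card_univ, Fintype.card_fin,
        nsmul_eq_mul]
      ring
    simp_rw [hl]
    rw [lintegral_const_mul' _ _ ENNReal.ofReal_ne_top]
    have e2 : ∀ u, (∏ i, ENNReal.ofReal (Φ u (x i) * Real.exp (1 - M u))) *
        ENNReal.ofReal (Real.exp (-(inner ℝ a u - ‖a‖ ^ 2 / 2))) *
          ENNReal.ofReal (Real.exp (inner ℝ a u - ‖a‖ ^ 2 / 2)) =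
        ∏ i, ENNReal.ofReal (Φ u (x i) * Real.exp (1 - M u)) := fun u => by
      rw [mul_assoc, ← ENNReal.ofReal_mul (Real.exp_pos _).le, ← Real.exp_add]
      simp
    simp only [Pi.mul_apply] at key
    rw [key]
    simp_rw [e2]
    calc ENNReal.ofReal η * pacStat γ P Φ x ≤ ENNReal.ofReal η * ENNReal.ofReal η⁻¹ := by gcongr
      _ = 1 := by
        rw [← ENNReal.ofReal_mul hη.le, mul_inv_cancel₀ hη.ne', ENNReal.ofReal_one]
  have hexpm : AEStronglyMeasurable (fun u => Real.exp (Y u)) γ :=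
    Real.continuous_exp.comp_aestronglyMeasurable hY.1
  have hexpi : Integrable (fun u => Real.exp (Y u)) γ := by
    refine ⟨hexpm, ?_⟩
    rw [hasFiniteIntegral_iff_ofReal (.of_forall fun u => (Real.exp_pos _).le)]
    exact lt_of_le_of_lt hexp ENNReal.one_lt_top
  have h1 : ∫ u, Real.exp (Y u) ∂γ ≤ 1 := by
    rw [integral_eq_lintegral_of_nonneg_ae (.of_forall fun u => (Real.exp_pos _).le) hexpm]
    exact ENNReal.toReal_le_of_le_ofReal zero_le_one (by simpa using hexp)
  -- The inequality `y + 1 ≤ exp y` replaces Jensen and gives `∫ Y ≤ 0`.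
  have h2 : ∫ u, (Y u + 1) ∂γ ≤ ∫ u, Real.exp (Y u) ∂γ :=
    integral_mono (hY.add (integrable_const 1)) hexpi fun u => Real.add_one_le_exp _
  rw [integral_add hY (integrable_const 1), hY0] at h2
  simp at h2
  simp only [Real.log_inv]
  linarith

/-! ### Moments of the data -/

section Moments

variable {d : ℕ} {P : Measure (EuclideanSpace ℝ (Fin d))}

theorem integrable_norm_sq [IsProbabilityMeasure P] (hP : Integrable (fun x => ‖x‖ ^ 4) P) :
    Integrable (fun x => ‖x‖ ^ 2) P := by
  refine ((integrable_const (1 : ℝ)).add hP).mono' (by fun_prop) (.of_forall fun x => ?_)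
  simp only [Pi.add_apply, norm_pow, norm_norm]
  nlinarith [sq_nonneg (‖x‖ ^ 2 - 1), sq_nonneg ‖x‖]

theorem inner_sq_le (θ x : EuclideanSpace ℝ (Fin d)) :
    (inner ℝ θ x) ^ 2 ≤ ‖θ‖ ^ 2 * ‖x‖ ^ 2 := by
  rw [← mul_pow]
  exact sq_le_sq' (by linarith [neg_abs_le (inner ℝ θ x), abs_real_inner_le_norm θ x])
    (real_inner_le_norm θ x)

theorem inner_pow_four_le (θ x : EuclideanSpace ℝ (Fin d)) :
    (inner ℝ θ x) ^ 4 ≤ ‖θ‖ ^ 4 * ‖x‖ ^ 4 := by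
  have h := inner_sq_le θ x
  calc (inner ℝ θ x) ^ 4 = ((inner ℝ θ x) ^ 2) ^ 2 := by ring
    _ ≤ (‖θ‖ ^ 2 * ‖x‖ ^ 2) ^ 2 := pow_le_pow_left₀ (sq_nonneg _) h 2
    _ = _ := by ring

theorem integrable_inner_sq [IsProbabilityMeasure P] (hP : Integrable (fun x => ‖x‖ ^ 4) P)
    (θ : EuclideanSpace ℝ (Fin d)) : Integrable (fun x => (inner ℝ θ x) ^ 2) P := by
  refine ((integrable_norm_sq hP).const_mul (‖θ‖ ^ 2)).mono' (by fun_prop)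
    (.of_forall fun x => ?_)
  rw [Real.norm_of_nonneg (sq_nonneg _)]
  exact inner_sq_le θ x

theorem integrable_inner_pow_four (hP : Integrable (fun x => ‖x‖ ^ 4) P)
    (θ : EuclideanSpace ℝ (Fin d)) : Integrable (fun x => (inner ℝ θ x) ^ 4) P := by
  refine (hP.const_mul (‖θ‖ ^ 4)).mono' (by fun_prop) (.of_forall fun x => ?_)
  rw [Real.norm_of_nonneg (by positivity)]
  exact inner_pow_four_le θ x

theorem quadForm_gram [IsProbabilityMeasure P] (hP : Integrable (fun x => ‖x‖ ^ 4) P)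
    (θ : EuclideanSpace ℝ (Fin d)) :
    quadForm (gram P) θ = ∫ x, (inner ℝ θ x) ^ 2 ∂P := by
  have hij : ∀ i j : Fin d, Integrable (fun x : EuclideanSpace ℝ (Fin d) => x i * x j) P := by
    intro i j
    refine (integrable_norm_sq hP).mono' (by fun_prop) (.of_forall fun x => ?_)
    rw [norm_mul, sq]
    exact mul_le_mul (PiLp.norm_apply_le x i) (PiLp.norm_apply_le x j) (norm_nonneg _)
      (norm_nonneg _)
  have e : ∀ x : EuclideanSpace ℝ (Fin d), (inner ℝ θ x) ^ 2 =
      ∑ i, ∑ j, θ i * θ j * (x i * x j) := by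
    intro x
    rw [sq, PiLp.inner_apply, Finset.sum_mul_sum]
    refine Finset.sum_congr rfl fun i _ => Finset.sum_congr rfl fun j _ => ?_
    simp; ring
  simp_rw [e]
  rw [integral_finsetSum _ fun i _ => integrable_finsetSum _ fun j _ => (hij i j).const_mul _]
  unfold quadForm
  refine Finset.sum_congr rfl fun i _ => ?_
  rw [integral_finsetSum _ fun j _ => (hij i j).const_mul _]
  refine Finset.sum_congr rfl fun j _ => ?_
  rw [integral_const_mul, gram, Matrix.of_apply]
  ring

theorem quadForm_gram_nonneg [IsProbabilityMeasure P] (hP : Integrable (fun x => ‖x‖ ^ 4) P)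
    (θ : EuclideanSpace ℝ (Fin d)) : 0 ≤ quadForm (gram P) θ := by
  rw [quadForm_gram hP]
  exact integral_nonneg fun x => sq_nonneg _

theorem sFourSq_sq (P : Measure (EuclideanSpace ℝ (Fin d))) :
    sFourSq P ^ 2 = ∫ x, ‖x‖ ^ 4 ∂P :=
  Real.sq_sqrt (integral_nonneg fun x => by positivity)

/-- Through `E‖X‖²`; the last comparison with `E‖X‖⁴` is the nonnegativity of the variance of
`‖X‖²`. -/
theorem quadForm_gram_le [IsProbabilityMeasure P] (hP : Integrable (fun x => ‖x‖ ^ 4) P)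
    {θ : EuclideanSpace ℝ (Fin d)}
    (hθ : ‖θ‖ = 1) : quadForm (gram P) θ ≤ sFourSq P := by
  rw [quadForm_gram hP]
  set I := ∫ x, ‖x‖ ^ 2 ∂P with hI
  have h1 : ∫ x, (inner ℝ θ x) ^ 2 ∂P ≤ I :=
    integral_mono (integrable_inner_sq hP θ) (integrable_norm_sq hP) fun x => by
      simpa [hθ] using inner_sq_le θ x
  refine h1.trans (Real.le_sqrt_of_sq_le ?_)
  have h2 : 0 ≤ ∫ x, (‖x‖ ^ 4 - 2 * I * ‖x‖ ^ 2 + I ^ 2) ∂P :=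
    integral_nonneg fun x => by
      simp only [Pi.zero_apply]
      nlinarith [sq_nonneg (‖x‖ ^ 2 - I)]
  have i1 : Integrable (fun x => ‖x‖ ^ 4 - 2 * I * ‖x‖ ^ 2) P :=
    hP.sub ((integrable_norm_sq hP).const_mul _)
  rw [integral_add i1 (integrable_const _),
    integral_sub hP ((integrable_norm_sq hP).const_mul _), integral_const_mul, ← hI] at h2
  simp at h2
  nlinarith

/-- If the second moment vanishes, so does `⟨θ, X⟩` almost surely. Otherwise the ratio is below the
supremum, which is a true one: an unbounded set of reals has `sSup` equal to `0`, excluded by `hκ`.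
-/
theorem integral_inner_pow_four_le [IsProbabilityMeasure P] (hP : Integrable (fun x => ‖x‖ ^ 4) P)
    (hκ : 0 < kurtosis P) (θ : EuclideanSpace ℝ (Fin d)) :
    ∫ x, (inner ℝ θ x) ^ 4 ∂P ≤ kurtosis P * (quadForm (gram P) θ) ^ 2 := by
  rw [quadForm_gram hP]
  rcases (integral_nonneg fun x => sq_nonneg (inner ℝ θ x) :
    0 ≤ ∫ x, (inner ℝ θ x) ^ 2 ∂P).eq_or_lt with h | h
  · have h0 := (integral_eq_zero_iff_of_nonneg (fun x => sq_nonneg (inner ℝ θ x))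
      (integrable_inner_sq hP θ)).1 h.symm
    have : ∫ x, (inner ℝ θ x) ^ 4 ∂P = 0 := by
      rw [← integral_zero (EuclideanSpace ℝ (Fin d)) ℝ (μ := P)]
      refine integral_congr_ae (h0.mono fun x hx => ?_)
      have : (inner ℝ θ x) ^ 2 = 0 := hx
      simp only
      rw [show (4 : ℕ) = 2 * 2 from rfl, pow_mul, this]; simp
    rw [this, ← h]; simp
  · rw [← div_le_iff₀ (by positivity)]
    unfold kurtosis at hκ ⊢
    refine le_csSup ?_ ⟨θ, h, rfl⟩
    by_contra hb
    rw [Real.sSup_of_not_bddAbove hb] at hκ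
    exact lt_irrefl _ hκ

theorem integrable_norm_sq_mul_inner_sq (hP : Integrable (fun x => ‖x‖ ^ 4) P)
    (θ : EuclideanSpace ℝ (Fin d)) :
    Integrable (fun x => ‖x‖ ^ 2 * (inner ℝ θ x) ^ 2) P := by
  refine (hP.const_mul (‖θ‖ ^ 2)).mono' (by fun_prop) (.of_forall fun x => ?_)
  rw [Real.norm_of_nonneg (by positivity)]
  nlinarith [inner_sq_le θ x, sq_nonneg ‖x‖]

/-- Cauchy–Schwarz, obtained by integrating `2 t u v ≤ t² u² + v²` and choosing `t`. -/
theorem integral_norm_sq_mul_inner_sq_le [IsProbabilityMeasure P]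
    (hP : Integrable (fun x => ‖x‖ ^ 4) P)
    (hκ : 0 < kurtosis P) (hs : 0 < sFourSq P) (θ : EuclideanSpace ℝ (Fin d)) :
    ∫ x, ‖x‖ ^ 2 * (inner ℝ θ x) ^ 2 ∂P ≤
      Real.sqrt (kurtosis P) * sFourSq P * quadForm (gram P) θ := by
  have h4 := integral_inner_pow_four_le hP hκ θ
  have hN := quadForm_gram_nonneg hP θ
  set N := quadForm (gram P) θ
  set κ := kurtosis P
  set s := sFourSq P with hs'
  have hsk : Real.sqrt κ ^ 2 = κ := Real.sq_sqrt hκ.le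
  have hsk0 : 0 < Real.sqrt κ := Real.sqrt_pos.2 hκ
  have key : ∀ t : ℝ, 2 * t * ∫ x, ‖x‖ ^ 2 * (inner ℝ θ x) ^ 2 ∂P ≤
      s ^ 2 * t ^ 2 + κ * N ^ 2 := by
    intro t
    have h1 : ∫ x, 2 * t * (‖x‖ ^ 2 * (inner ℝ θ x) ^ 2) ∂P ≤
        ∫ x, (t ^ 2 * ‖x‖ ^ 4 + (inner ℝ θ x) ^ 4) ∂P := by
      refine integral_mono ((integrable_norm_sq_mul_inner_sq hP θ).const_mul _)
        ((hP.const_mul _).add (integrable_inner_pow_four hP θ)) fun x => ?_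
      simp only
      nlinarith [sq_nonneg (t * ‖x‖ ^ 2 - (inner ℝ θ x) ^ 2)]
    rw [integral_const_mul, integral_add (hP.const_mul _) (integrable_inner_pow_four hP θ),
      integral_const_mul, ← sFourSq_sq] at h1
    linarith
  rcases hN.eq_or_lt with h | h
  · have h1 := key 1
    rw [← h] at h1 ⊢
    set J := ∫ x, ‖x‖ ^ 2 * (inner ℝ θ x) ^ 2 ∂P
    have h2 := key (J / s ^ 2)
    rw [← h] at h2
    have : J / s ^ 2 * s ^ 2 = J := by field_simp
    have h3 : J ^ 2 / s ^ 2 ≤ 0 := by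
      have e : 2 * (J / s ^ 2) * J = 2 * (J ^ 2 / s ^ 2) := by ring
      have e' : s ^ 2 * (J / s ^ 2) ^ 2 = J ^ 2 / s ^ 2 := by field_simp
      rw [e, e'] at h2
      linarith
    have h4 : J ^ 2 ≤ 0 := by
      by_contra hh
      push Not at hh
      have : 0 < J ^ 2 / s ^ 2 := by positivity
      linarith
    nlinarith
  · have h1 := key (Real.sqrt κ * N / s)
    have e : s ^ 2 * (Real.sqrt κ * N / s) ^ 2 = κ * N ^ 2 := by
      rw [div_pow, mul_pow, hsk]; field_simp
    rw [e] at h1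
    have h2 : 0 < Real.sqrt κ * N / s := by positivity
    have h3 : Real.sqrt κ * N / s * ∫ x, ‖x‖ ^ 2 * (inner ℝ θ x) ^ 2 ∂P ≤
        Real.sqrt κ * N / s * (Real.sqrt κ * s * N) := by
      have e2 : Real.sqrt κ * N / s * (Real.sqrt κ * s * N) = Real.sqrt κ ^ 2 * N ^ 2 := by
        field_simp
      rw [e2, hsk]; linarith
    exact le_of_mul_le_mul_left h3 h2

end Moments

/-! ### The deviation inequality for the truncated criterion -/

/-- The function of the perturbed parameter and of the observation whose logarithm dominates the
influence function in expectation. -/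
def perturbedAt {d : ℕ} (e l b : ℝ) (u x : EuclideanSpace ℝ (Fin d)) : ℝ :=
  perturbed cst e l (‖x‖ ^ 2 / b) (inner ℝ ((Real.sqrt b)⁻¹ • u) x)

section Deviation

variable {d : ℕ}

theorem cst_nonneg : 0 ≤ cst := by linarith [thirty_le_cst]

theorem measurable_perturbedAt (e l b : ℝ) :
    Measurable (Function.uncurry (perturbedAt (d := d) e l b)) := by
  unfold perturbedAt perturbed Function.uncurry
  fun_prop

theorem half_le_perturbedAt (e l : ℝ) {b : ℝ} (hb : 0 < b) (u x : EuclideanSpace ℝ (Fin d)) :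
    1 / 2 ≤ perturbedAt e l b u x :=
  half_le_perturbed cst_nonneg (by positivity) _ _ _

theorem perturbed_le {c e l v w : ℝ} (hc : 0 ≤ c) (he : e ^ 2 = 1) :
    perturbed c e l v w ≤ (3 / 2 + 3 * l ^ 2) + (3 + c) * (w ^ 4 + v ^ 2) := by
  unfold perturbed
  set z := e * (w ^ 2 - v - l) with hz
  have h1 : z ^ 2 = (w ^ 2 - v - l) ^ 2 := by rw [hz, mul_pow, he, one_mul]
  have h2 : z ^ 2 ≤ 3 * (w ^ 4 + v ^ 2 + l ^ 2) := by
    rw [h1]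
    nlinarith [sq_nonneg (w ^ 2 + v), sq_nonneg (w ^ 2 + l), sq_nonneg (v - l)]
  have h3 : c * v * (w ^ 2 + v / 2) ≤ c * (w ^ 4 + v ^ 2) := by
    rw [mul_assoc]
    apply mul_le_mul_of_nonneg_left _ hc
    nlinarith [sq_nonneg (w ^ 2 - v), sq_nonneg (w ^ 2)]
  nlinarith [sq_nonneg (z - 1)]

/-- The bound separates `u` from `x`, so fourth moments of the Gaussian and of the data suffice for
joint integrability. -/
theorem perturbedAt_le (e l b : ℝ) (he : e ^ 2 = 1) (u x : EuclideanSpace ℝ (Fin d)) :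
    perturbedAt e l b u x ≤ (3 / 2 + 3 * l ^ 2) +
      (3 + cst) * (‖(Real.sqrt b)⁻¹ • u‖ ^ 4 + (b⁻¹) ^ 2) * ‖x‖ ^ 4 := by
  refine (perturbed_le cst_nonneg he).trans ?_
  have h1 := inner_pow_four_le ((Real.sqrt b)⁻¹ • u) x
  have e : (‖x‖ ^ 2 / b) ^ 2 = (b⁻¹) ^ 2 * ‖x‖ ^ 4 := by ring
  rw [e, mul_assoc]
  have := cst_nonneg
  gcongr
  linarith

theorem integrable_perturbedAt {P : Measure (EuclideanSpace ℝ (Fin d))} [IsProbabilityMeasure P]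
    (hP : Integrable (fun x => ‖x‖ ^ 4) P) {e l b : ℝ} (hb : 0 < b) (he : e ^ 2 = 1)
    (u : EuclideanSpace ℝ (Fin d)) : Integrable (perturbedAt e l b u) P := by
  refine ((integrable_const (3 / 2 + 3 * l ^ 2)).add (hP.const_mul
    ((3 + cst) * (‖(Real.sqrt b)⁻¹ • u‖ ^ 4 + (b⁻¹) ^ 2)))).mono' ?_ (.of_forall fun x => ?_)
  · exact ((measurable_perturbedAt e l b).comp measurable_prodMk_left).aestronglyMeasurable
  · rw [Real.norm_of_nonneg (by linarith [half_le_perturbedAt e l hb u x])]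
    exact perturbedAt_le e l b he u x

theorem integrable_perturbedAt_prod {P : Measure (EuclideanSpace ℝ (Fin d))}
    [IsProbabilityMeasure P] (hP : Integrable (fun x => ‖x‖ ^ 4) P) {e l b : ℝ} (hb : 0 < b)
    (he : e ^ 2 = 1) (a : EuclideanSpace ℝ (Fin d)) :
    Integrable (fun p : EuclideanSpace ℝ (Fin d) × EuclideanSpace ℝ (Fin d) =>
      perturbedAt e l b (a + p.1) p.2) ((stdGaussian (EuclideanSpace ℝ (Fin d))).prod P) := by
  have h4 : Integrable (fun u : EuclideanSpace ℝ (Fin d) => ‖(Real.sqrt b)⁻¹ • (a + u)‖ ^ 4)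
      (stdGaussian (EuclideanSpace ℝ (Fin d))) := by
    have h := ((memLp_const a).add (IsGaussian.memLp_id
      (stdGaussian (EuclideanSpace ℝ (Fin d))) 4 (by simp))).const_smul ((Real.sqrt b)⁻¹)
    have := h.integrable_norm_pow (p := 4) (by norm_num)
    exact this
  have h5 := (((h4.add (integrable_const ((b⁻¹) ^ 2))).const_mul (3 + cst)).mul_prod hP)
  refine ((integrable_const (3 / 2 + 3 * l ^ 2)).add h5).mono' ?_ (.of_forall fun p => ?_)
  · have : Measurable fun p : EuclideanSpace ℝ (Fin d) × EuclideanSpace ℝ (Fin d) =>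
        (a + p.1, p.2) := by fun_prop
    exact ((measurable_perturbedAt e l b).comp this).aestronglyMeasurable
  · rw [Real.norm_of_nonneg (by linarith [half_le_perturbedAt e l hb (a + p.1) p.2])]
    exact perturbedAt_le e l b he (a + p.1) p.2

theorem stdGaussian_map_inner {b : ℝ} (hb : 0 < b) (x : EuclideanSpace ℝ (Fin d)) :
    (stdGaussian (EuclideanSpace ℝ (Fin d))).map (fun u => inner ℝ ((Real.sqrt b)⁻¹ • u) x) =
      gaussianReal 0 (‖x‖ ^ 2 / b).toNNReal := by
  have h := IsGaussian.map_eq_gaussianReal (μ := stdGaussian (EuclideanSpace ℝ (Fin d)))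
    (innerSL ℝ ((Real.sqrt b)⁻¹ • x))
  rw [integral_strongDual_stdGaussian, variance_dual_stdGaussian, innerSL_apply_norm, norm_smul,
    mul_pow, norm_inv, Real.norm_of_nonneg (Real.sqrt_nonneg b), inv_pow, Real.sq_sqrt hb.le] at h
  rw [div_eq_inv_mul, ← h]
  congr 1
  ext u
  rw [innerSL_apply_apply, real_inner_smul_left, real_inner_smul_left, real_inner_comm]

/-- Translating the standard Gaussian by `√b θ` gives `u / √b` the law `N(θ, b⁻¹ I)`, at the cost
`‖√b θ‖²/2 = b‖θ‖²/2`. -/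
theorem perturbedAt_add (e l : ℝ) {b : ℝ} (hb : 0 < b) (θ u x : EuclideanSpace ℝ (Fin d)) :
    perturbedAt e l b (Real.sqrt b • θ + u) x =
      perturbed cst e l ((‖x‖ ^ 2 / b).toNNReal : ℝ)
        (inner ℝ θ x + inner ℝ ((Real.sqrt b)⁻¹ • u) x) := by
  have hs : 0 < Real.sqrt b := Real.sqrt_pos.2 hb
  unfold perturbedAt
  rw [Real.coe_toNNReal _ (by positivity), smul_add, smul_smul, inv_mul_cancel₀ hs.ne', one_smul,
    inner_add_left]

theorem integral_perturbedAt {e l b : ℝ} (hb : 0 < b) (he : e ^ 2 = 1)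
    (θ x : EuclideanSpace ℝ (Fin d)) :
    ∫ u, perturbedAt e l b (Real.sqrt b • θ + u) x ∂(stdGaussian (EuclideanSpace ℝ (Fin d))) =
      1 + e * ((inner ℝ θ x) ^ 2 - l) + ((inner ℝ θ x) ^ 2 - l) ^ 2 / 2
        + (2 + cst) / b * (‖x‖ ^ 2 * (inner ℝ θ x) ^ 2)
        + (2 + 3 * cst) / (2 * b ^ 2) * ‖x‖ ^ 4 := by
  simp_rw [perturbedAt_add e l hb]
  have h := integral_map (μ := stdGaussian (EuclideanSpace ℝ (Fin d)))
    (φ := fun u => inner ℝ ((Real.sqrt b)⁻¹ • u) x)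
    (f := fun y => perturbed cst e l ((‖x‖ ^ 2 / b).toNNReal : ℝ) (inner ℝ θ x + y))
    (by fun_prop) (by unfold perturbed; fun_prop)
  rw [← h, stdGaussian_map_inner hb, integral_perturbed _ _ _ _ _ he,
    Real.coe_toNNReal _ (by positivity)]
  field_simp

theorem psi_le_integral_log_perturbedAt {e l b : ℝ} (hb : 0 < b) (he : e ^ 2 = 1)
    (θ x : EuclideanSpace ℝ (Fin d)) :
    psi (e * ((inner ℝ θ x) ^ 2 - l)) ≤
      ∫ u, Real.log (perturbedAt e l b (Real.sqrt b • θ + u) x)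
        ∂(stdGaussian (EuclideanSpace ℝ (Fin d))) := by
  simp_rw [perturbedAt_add e l hb]
  have h := integral_map (μ := stdGaussian (EuclideanSpace ℝ (Fin d)))
    (φ := fun u => inner ℝ ((Real.sqrt b)⁻¹ • u) x)
    (f := fun y => Real.log (perturbed cst e l ((‖x‖ ^ 2 / b).toNNReal : ℝ) (inner ℝ θ x + y)))
    (by fun_prop) (by
      have : Measurable fun y => perturbed cst e l ((‖x‖ ^ 2 / b).toNNReal : ℝ)
        (inner ℝ θ x + y) := by unfold perturbed; fun_prop
      exact (Real.measurable_log.comp this).aestronglyMeasurable)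
  rw [← h, stdGaussian_map_inner hb]
  exact psi_le_integral_log_perturbed thirty_le_cst he l (inner ℝ θ x) _

/-- The Gaussian average is explicit, and three moments of the data remain: `E⟨θ, X⟩⁴ ≤ κ N²` yields
the term `(κ - 1) N²`, Cauchy–Schwarz handles the mixed moment, and the last one is `E‖X‖⁴`. -/
theorem integral_integral_perturbedAt_le {P : Measure (EuclideanSpace ℝ (Fin d))}
    [IsProbabilityMeasure P] (hP : Integrable (fun x => ‖x‖ ^ 4) P) (hκ : 0 < kurtosis P)
    (hs : 0 < sFourSq P) {e l b : ℝ} (hb : 0 < b) (he : e ^ 2 = 1)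
    (θ : EuclideanSpace ℝ (Fin d)) {N : ℝ} (hN : N = quadForm (gram P) θ) :
    ∫ u, ∫ x, perturbedAt e l b (Real.sqrt b • θ + u) x ∂P
        ∂(stdGaussian (EuclideanSpace ℝ (Fin d))) - 1 ≤
      e * (N - l) + ((N - l) ^ 2 + (kurtosis P - 1) * N ^ 2) / 2
        + (2 + cst) * Real.sqrt (kurtosis P) * sFourSq P * N / b
        + (2 + 3 * cst) * sFourSq P ^ 2 / (2 * b ^ 2) := by
  rw [integral_integral_swap (integrable_perturbedAt_prod hP hb he _)]
  simp_rw [integral_perturbedAt hb he]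
  have h2 := integrable_inner_sq hP θ
  have h4 := integrable_inner_pow_four hP θ
  have h22 := integrable_norm_sq_mul_inner_sq hP θ
  have e1 : ∀ x : EuclideanSpace ℝ (Fin d), 1 + e * ((inner ℝ θ x) ^ 2 - l)
        + ((inner ℝ θ x) ^ 2 - l) ^ 2 / 2
        + (2 + cst) / b * (‖x‖ ^ 2 * (inner ℝ θ x) ^ 2)
        + (2 + 3 * cst) / (2 * b ^ 2) * ‖x‖ ^ 4 =
      (1 - e * l + l ^ 2 / 2) + (e - l) * (inner ℝ θ x) ^ 2 + 1 / 2 * (inner ℝ θ x) ^ 4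
        + (2 + cst) / b * (‖x‖ ^ 2 * (inner ℝ θ x) ^ 2)
        + (2 + 3 * cst) / (2 * b ^ 2) * ‖x‖ ^ 4 := fun x => by ring
  simp_rw [e1]
  have i1 : Integrable (fun x => (1 - e * l + l ^ 2 / 2) + (e - l) * (inner ℝ θ x) ^ 2) P :=
    (integrable_const _).add (h2.const_mul _)
  have i2 : Integrable (fun x => (1 - e * l + l ^ 2 / 2) + (e - l) * (inner ℝ θ x) ^ 2
      + 1 / 2 * (inner ℝ θ x) ^ 4) P := i1.add (h4.const_mul _)
  have i3 : Integrable (fun x => (1 - e * l + l ^ 2 / 2) + (e - l) * (inner ℝ θ x) ^ 2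
      + 1 / 2 * (inner ℝ θ x) ^ 4 + (2 + cst) / b * (‖x‖ ^ 2 * (inner ℝ θ x) ^ 2)) P :=
    i2.add (h22.const_mul _)
  rw [integral_add i3 (hP.const_mul _), integral_add i2 (h22.const_mul _),
    integral_add i1 (h4.const_mul _), integral_add (integrable_const _) (h2.const_mul _)]
  simp only [integral_const_mul, integral_const, probReal_univ, one_smul]
  rw [← quadForm_gram hP, ← hN, ← sFourSq_sq]
  have k1 := integral_inner_pow_four_le hP hκ θ
  have k2 := integral_norm_sq_mul_inner_sq_le hP hκ hs θ
  rw [← hN] at k1 k2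
  have k3 : (2 + cst) / b * ∫ x, ‖x‖ ^ 2 * (inner ℝ θ x) ^ 2 ∂P ≤
      (2 + cst) / b * (Real.sqrt (kurtosis P) * sFourSq P * N) := by
    have := cst_nonneg
    gcongr
  have e2 : (2 + cst) / b * (Real.sqrt (kurtosis P) * sFourSq P * N) =
      (2 + cst) * Real.sqrt (kurtosis P) * sFourSq P * N / b := by ring
  have e3 : (2 + 3 * cst) / (2 * b ^ 2) * sFourSq P ^ 2 =
      (2 + 3 * cst) * sFourSq P ^ 2 / (2 * b ^ 2) := by ring
  rw [e2] at k3
  rw [e3]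
  linarith

/-- One-sided deviation inequality for the truncated criterion (the side is the sign `e`), on the
event where the exponential statistic is small. -/
theorem mean_psi_le {n : ℕ} (hn : 0 < n) {P : Measure (EuclideanSpace ℝ (Fin d))}
    [IsProbabilityMeasure P] (hP : Integrable (fun x => ‖x‖ ^ 4) P) (hκ : 0 < kurtosis P)
    (hs : 0 < sFourSq P) {e l b : ℝ} (hb : 0 < b) (he : e ^ 2 = 1) {η : ℝ} (hη : 0 < η)
    {x : Fin n → EuclideanSpace ℝ (Fin d)}
    (hx : pacStat (stdGaussian (EuclideanSpace ℝ (Fin d))) P (perturbedAt e l b) x ≤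
      ENNReal.ofReal η⁻¹)
    (θ : EuclideanSpace ℝ (Fin d)) {N : ℝ} (hN : N = quadForm (gram P) θ) :
    (n : ℝ)⁻¹ * ∑ i, psi (e * ((inner ℝ θ (x i)) ^ 2 - l)) ≤
      e * (N - l) + (((N - l) ^ 2 + (kurtosis P - 1) * N ^ 2) / 2
        + (2 + cst) * Real.sqrt (kurtosis P) * sFourSq P * N / b
        + (2 + 3 * cst) * sFourSq P ^ 2 / (2 * b ^ 2)
        + b * ‖θ‖ ^ 2 / (2 * n) + Real.log η⁻¹ / n) := by
  have hpr := integrable_perturbedAt_prod hP (l := l) hb he (Real.sqrt b • θ)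
  have hi : ∀ i, Integrable (fun u => perturbedAt e l b (Real.sqrt b • θ + u) (x i))
      (stdGaussian (EuclideanSpace ℝ (Fin d))) := by
    intro i
    -- A fixed observation is treated as random with a Dirac law, so that the integrability on the
    -- product applies.
    have hd : Integrable (fun y : EuclideanSpace ℝ (Fin d) => ‖y‖ ^ 4) (Measure.dirac (x i)) :=
      integrable_dirac (by simp)
    have := (integrable_perturbedAt_prod hd (l := l) hb he (Real.sqrt b • θ)).integral_prod_left
    simpa using this
  have key := sum_integral_log_le (measurable_perturbedAt e l b)
    (fun u s => by linarith [half_le_perturbedAt e l hb u s]) x hη hx (Real.sqrt b • θ)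
    (fun i => integrable_log_of_half_le (hi i) fun u => half_le_perturbedAt e l hb _ _)
    hpr.integral_prod_left
  have h1 : ∑ i, psi (e * ((inner ℝ θ (x i)) ^ 2 - l)) ≤ _ :=
    (Finset.sum_le_sum fun i _ => psi_le_integral_log_perturbedAt (l := l) hb he θ (x i)).trans key
  have h2 := integral_integral_perturbedAt_le hP hκ hs (l := l) hb he θ hN
  have hn' : (0 : ℝ) < n := by exact_mod_cast hn
  have e3 : ‖Real.sqrt b • θ‖ ^ 2 = b * ‖θ‖ ^ 2 := by
    rw [norm_smul, mul_pow, Real.norm_of_nonneg (Real.sqrt_nonneg b), Real.sq_sqrt hb.le]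
  rw [e3] at h1
  rw [inv_mul_le_iff₀ hn']
  refine h1.trans ?_
  have h3 := mul_le_mul_of_nonneg_left h2 hn'.le
  have e4 : (n : ℝ) * (b * ‖θ‖ ^ 2 / (2 * n)) = b * ‖θ‖ ^ 2 / 2 := by field_simp
  have e5 : (n : ℝ) * (Real.log η⁻¹ / n) = Real.log η⁻¹ := by field_simp
  nlinarith

end Deviation

/-! ### The deviation event -/

theorem quadForm_smul {d : ℕ} (M : Matrix (Fin d) (Fin d) ℝ) (α : ℝ)
    (θ : EuclideanSpace ℝ (Fin d)) : quadForm M (α • θ) = α ^ 2 * quadForm M θ := by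
  unfold quadForm
  rw [Finset.mul_sum]
  refine Finset.sum_congr rfl fun i _ => ?_
  rw [Finset.mul_sum]
  refine Finset.sum_congr rfl fun j _ => ?_
  simp; ring

theorem numScales_pos (n : ℕ) (a κ : ℝ) : 0 < numScales n a κ := by
  unfold numScales; omega

theorem precision_pos {n : ℕ} (hn : 0 < n) (a : ℝ) {κ s2 : ℝ} (hκ : 0 < κ) (hs : 0 < s2) (j : ℕ) :
    0 < precision n a κ s2 j := by
  unfold precision
  have := cst_nonneg
  have : 0 < Real.sqrt κ := Real.sqrt_pos.2 hκ
  have : (0 : ℝ) < n := by exact_mod_cast hn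
  positivity

theorem abs_criterion_le {d n : ℕ} (hn : 0 < n) {P : Measure (EuclideanSpace ℝ (Fin d))}
    [IsProbabilityMeasure P] (hP : Integrable (fun x => ‖x‖ ^ 4) P) (hκ : 0 < kurtosis P)
    (hs : 0 < sFourSq P) {a ε : ℝ} (hε : 0 < ε) {l b : ℝ} (hb : 0 < b)
    {x : Fin n → EuclideanSpace ℝ (Fin d)}
    (hx : ∀ e : ℝ, e ^ 2 = 1 →
      pacStat (stdGaussian (EuclideanSpace ℝ (Fin d))) P (perturbedAt e l b) x ≤
        ENNReal.ofReal (ε / numScales n a (kurtosis P))⁻¹)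
    (θ : EuclideanSpace ℝ (Fin d)) :
    |criterion x l θ - (quadForm (gram P) θ - l)| ≤
      deviation n a ε (kurtosis P) (sFourSq P) l b (quadForm (gram P) θ) θ := by
  have hη : 0 < ε / numScales n a (kurtosis P) :=
    div_pos hε (by exact_mod_cast numScales_pos n a _)
  have h1 := mean_psi_le hn hP hκ hs hb (by norm_num) hη (hx 1 (by norm_num)) θ rfl
  have h2 := mean_psi_le hn hP hκ hs hb (by norm_num) hη (hx (-1) (by norm_num)) θ rfl
  simp only [one_mul, neg_mul, psi_neg, Finset.sum_neg_distrib, mul_neg, inv_div] at h1 h2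
  unfold criterion deviation
  rw [abs_le]
  constructor <;> linarith

/-- Union bound over `K` scales and two signs, each failing with probability at most `ε / K`.
Uniformity in `θ` and `α` is free, because the statistic does not involve the centre of the
perturbation. -/
theorem exists_deviation_event {Ω : Type*} [MeasurableSpace Ω] (μ : Measure Ω)
    [IsProbabilityMeasure μ] {d n : ℕ} (hn : 0 < n) {P : Measure (EuclideanSpace ℝ (Fin d))}
    [IsProbabilityMeasure P] (hP : Integrable (fun x => ‖x‖ ^ 4) P) (hκ : 0 < kurtosis P)
    (hs : 0 < sFourSq P) {X : Fin n → Ω → EuclideanSpace ℝ (Fin d)}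
    (hX : ∀ i, Measurable (X i)) (hindep : iIndepFun X μ) (hlaw : ∀ i, μ.map (X i) = P)
    (a : ℝ) {ε : ℝ} (hε : 0 < ε) :
    ∃ A : Set Ω, MeasurableSet A ∧ 1 - 2 * ε ≤ μ.real A ∧ ∀ ω ∈ A, ∀ θ,
      quadForm (gram P) θ ∈
        confidenceRegion a ε (kurtosis P) (sFourSq P) (fun k => X k ω) θ := by
  set κ := kurtosis P with hκdef
  set K := numScales n a κ with hK
  have hK0 : (0 : ℝ) < K := by exact_mod_cast numScales_pos n a κ
  set γ := stdGaussian (EuclideanSpace ℝ (Fin d)) with hγ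
  have hη : 0 < ε / K := div_pos hε hK0
  let bad : ℝ → ℕ → Set Ω := fun e j => {ω | ENNReal.ofReal (ε / K)⁻¹ < pacStat γ P
    (perturbedAt e (level n a ε κ j) (precision n a κ (sFourSq P) j)) (fun i => X i ω)}
  have hbad : ∀ e : ℝ, e ^ 2 = 1 → ∀ j, μ.real (bad e j) ≤ ε / K := fun e he j =>
    have hb := precision_pos hn a hκ hs j
    measure_pacStat_gt_le (measurable_perturbedAt _ _ _)
      (fun u s => by linarith [half_le_perturbedAt e (level n a ε κ j) hb u s])
      (fun u => integrable_perturbedAt hP hb he u) hX hindep hlaw hη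
  have hbadm : ∀ e j, MeasurableSet (bad e j) := fun e j =>
    measurableSet_lt measurable_const
      ((measurable_pacStat (measurable_perturbedAt _ _ _)).comp (measurable_pi_lambda _ hX))
  have hBm : MeasurableSet (⋃ j ∈ Finset.range K, (bad 1 j ∪ bad (-1) j)) :=
    Finset.measurableSet_biUnion _ fun j _ => (hbadm _ j).union (hbadm _ j)
  refine ⟨(⋃ j ∈ Finset.range K, (bad 1 j ∪ bad (-1) j))ᶜ, hBm.compl, ?_, ?_⟩
  · rw [probReal_compl_eq_one_sub hBm]
    have h1 : μ.real (⋃ j ∈ Finset.range K, (bad 1 j ∪ bad (-1) j)) ≤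
        ∑ j ∈ Finset.range K, (ε / K + ε / K) :=
      (measureReal_biUnion_finset_le _ _).trans (Finset.sum_le_sum fun j _ =>
        (measureReal_union_le _ _).trans
          (add_le_add (hbad 1 (by norm_num) j) (hbad (-1) (by norm_num) j)))
    have h2 : ∑ j ∈ Finset.range K, (ε / K + ε / K) = 2 * ε := by
      rw [Finset.sum_const, Finset.card_range, nsmul_eq_mul]; field_simp; ring
    linarith
  · intro ω hω θ
    simp only [Set.mem_compl_iff, Set.mem_iUnion, Set.mem_union, not_exists, not_or,
      Finset.mem_range] at hω
    refine ⟨quadForm_gram_nonneg hP θ, fun j hj α _ => ?_⟩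
    rw [← quadForm_smul]
    refine abs_criterion_le hn hP hκ hs hε (precision_pos hn a hκ hs j) (fun e he => ?_) _
    rcases (by simpa using he : e = 1 ∨ e = -1) with rfl | rfl
    · exact not_lt.1 (hω j hj).1
    · exact not_lt.1 (hω j hj).2

/-! ### The width of the confidence region -/

/-- Expand `(eᵗ S - R)(R - e⁻ᵗ S) ≥ 0`. The factor `cosh t` is the price of balancing two terms only
up to a ratio `e^{±t}`. -/
theorem sq_add_sq_le_mul_cosh {R S t : ℝ} (h1 : R ≤ Real.exp t * S)
    (h2 : S ≤ Real.exp t * R) : R ^ 2 + S ^ 2 ≤ 2 * R * S * Real.cosh t := by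
  have h3 : Real.exp (-t) * S ≤ R := by
    rw [Real.exp_neg, inv_mul_le_iff₀ (Real.exp_pos t)]; exact h2
  have e : Real.exp t * Real.exp (-t) = 1 := by rw [← Real.exp_add]; simp
  rw [Real.cosh_eq]
  nlinarith [mul_nonneg (sub_nonneg.2 h1) (sub_nonneg.2 h3)]

theorem exp_le_two_mul_cosh (t : ℝ) : Real.exp t ≤ 2 * Real.cosh t := by
  rw [Real.cosh_eq]; linarith [Real.exp_pos (-t)]

/-- The terms of the deviation bound that do not increase with the precision of the perturbation,
at a scale `y` close to the optimal one. -/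
theorem variance_terms_le {n κ w g L s2 τ a y : ℝ} (hn : 0 < n) (hκ : 1 < κ) (hw : 0 < w)
    (hg : 0 < g) (hL : 0 < L) (hs : 0 < s2) (hτ : 0 < τ)
    (hy : |y - Real.log (s2 / τ)| ≤ a / 2) {l β z : ℝ}
    (hl : l = Real.sqrt (2 / (n * (κ - 1)) * (g / (4 * w) * Real.exp y + L)))
    (hβ : β = s2 * Real.sqrt (2 * w * n * Real.exp (-(y - a / 2))))
    (hz : z = Real.sqrt (2 * (κ - 1) * (g * s2 / (4 * w * τ) + L)) * Real.cosh (a / 4)) :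
    0 < l ∧ (κ - 1) * l ^ 2 / 2 + g * s2 ^ 2 / (2 * β ^ 2) + L / n ≤ l * ((Real.sqrt n)⁻¹ * z) ∧
      l * (κ - 1) ≤ 2 * ((Real.sqrt n)⁻¹ * z) := by
  have hκ' : 0 < κ - 1 := by linarith
  set r := s2 / τ with hr
  have hr0 : 0 < r := div_pos hs hτ
  set A := g / (4 * w) with hA
  have hA0 : 0 < A := by positivity
  set E := Real.exp y with hE
  have hE0 : 0 < E := Real.exp_pos y
  obtain ⟨hy1, hy2⟩ := abs_le.1 hy
  have hEr : E ≤ Real.exp (a / 2) * r := by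
    rw [← Real.exp_log hr0, ← Real.exp_add]; exact Real.exp_le_exp.2 (by linarith)
  have hrE : r ≤ Real.exp (a / 2) * E := by
    rw [← Real.exp_log hr0, ← Real.exp_add]; exact Real.exp_le_exp.2 (by linarith)
  have he1 : 1 ≤ Real.exp (a / 2) := Real.one_le_exp (le_trans (abs_nonneg _) hy)
  have eAr : g * s2 / (4 * w * τ) = A * r := by rw [hA, hr]; field_simp
  rw [eAr] at hz
  -- `R` is the level up to a factor and `S` its value at the ideal scale `log r`. Under the square
  -- root, a scale error of `a / 2` becomes a ratio of at most `e^{a/4}`.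
  set R := Real.sqrt (2 * (κ - 1) * (A * E + L)) with hR
  set S := Real.sqrt (2 * (κ - 1) * (A * r + L)) with hS
  have hR0 : 0 < R := Real.sqrt_pos.2 (by positivity)
  have hS0 : 0 < S := Real.sqrt_pos.2 (by positivity)
  have hR2 : R ^ 2 = 2 * (κ - 1) * (A * E + L) := Real.sq_sqrt (by positivity)
  have hS2 : S ^ 2 = 2 * (κ - 1) * (A * r + L) := Real.sq_sqrt (by positivity)
  have he4 : Real.exp (a / 2) = Real.exp (a / 4) ^ 2 := by
    rw [← Real.exp_nat_mul]; congr 1; push_cast; ring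
  have hL1 : L ≤ Real.exp (a / 2) * L := le_mul_of_one_le_left hL.le he1
  have hκ2 : 0 ≤ 2 * (κ - 1) := by linarith
  have hRS : R ≤ Real.exp (a / 4) * S := by
    apply Real.sqrt_le_iff.2 ⟨by positivity, ?_⟩
    rw [mul_pow, hS2, ← he4]
    have h1 := mul_le_mul_of_nonneg_left hEr hA0.le
    have h2 := mul_le_mul_of_nonneg_left (add_le_add h1 hL1) hκ2
    linarith
  have hSR : S ≤ Real.exp (a / 4) * R := by
    apply Real.sqrt_le_iff.2 ⟨by positivity, ?_⟩
    rw [mul_pow, hR2, ← he4]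
    have h1 := mul_le_mul_of_nonneg_left hrE hA0.le
    have h2 := mul_le_mul_of_nonneg_left (add_le_add h1 hL1) hκ2
    linarith
  set N := Real.sqrt n with hN
  have hN0 : 0 < N := Real.sqrt_pos.2 hn
  have hN2 : N ^ 2 = n := Real.sq_sqrt hn.le
  have hlR : l = R / (N * (κ - 1)) := by
    rw [hl, Real.sqrt_eq_iff_mul_self_eq_of_pos (by positivity), ← sq, div_pow, hR2, mul_pow, hN2]
    field_simp
  have hl0 : 0 < l := by rw [hlR]; positivity
  have hβ2 : β ^ 2 = s2 ^ 2 * (2 * w * n * Real.exp (-(y - a / 2))) := by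
    rw [hβ, mul_pow, Real.sq_sqrt (by positivity)]
  set F := Real.exp (-(y - a / 2)) with hF
  have hF0 : 0 < F := Real.exp_pos _
  -- The half-step shift in the precision keeps it above its ideal value, so the term in `β⁻²` is at
  -- most its ideal value `A r / n`.
  have hrF : 1 ≤ r * F := by
    rw [hF, ← Real.exp_log hr0, ← Real.exp_add]; exact Real.one_le_exp (by linarith)
  have hc1 := sq_add_sq_le_mul_cosh hRS hSR
  refine ⟨hl0, ?_, ?_⟩
  · have h1 : g * s2 ^ 2 / (2 * β ^ 2) ≤ A * r / n := by
      have : g * s2 ^ 2 / (2 * β ^ 2) = A / (n * F) := by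
        rw [hβ2, hA]; field_simp; ring
      rw [this, div_le_div_iff₀ (by positivity) hn]
      have := mul_le_mul_of_nonneg_left hrF (mul_pos hA0 hn).le
      linarith
    have h2 : (κ - 1) * l ^ 2 / 2 + (A * r / n + L / n) =
        l * (N⁻¹ * ((R ^ 2 + S ^ 2) / (2 * R))) := by
      have e1 : A * r / n + L / n = S ^ 2 / (2 * (κ - 1)) / N ^ 2 := by
        rw [hS2, hN2]; field_simp
      rw [e1, hlR]; field_simp
    have h3 : (R ^ 2 + S ^ 2) / (2 * R) ≤ z := by
      rw [hz, div_le_iff₀ (by positivity)]; linarith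
    have h4 : l * (N⁻¹ * ((R ^ 2 + S ^ 2) / (2 * R))) ≤ l * (N⁻¹ * z) := by
      gcongr
    linarith
  · have h1 : l * (κ - 1) = N⁻¹ * R := by rw [hlR]; field_simp
    rw [h1]
    have h2 : R ≤ 2 * z := by
      have := mul_le_mul_of_nonneg_right (exp_le_two_mul_cosh (a / 4)) hS0.le
      rw [hz]; linarith
    have : N⁻¹ * R ≤ N⁻¹ * (2 * z) := by gcongr
    linarith

/-- The terms of the deviation bound balanced by the precision of the perturbation, at a scale `y`
close to the optimal one. -/
theorem precision_terms_le {n w s2 τ a y : ℝ} (hn : 0 < n) (hw : 0 < w) (hs : 0 < s2)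
    (hτ : 0 < τ) (hy : |y - Real.log (s2 / τ)| ≤ a / 2) {l β z : ℝ} (hl0 : 0 < l)
    (hβ : β = s2 * Real.sqrt (2 * w * n * Real.exp (-(y - a / 2))))
    (hz : z = Real.sqrt (2 * w * s2 / τ) * Real.cosh (a / 2)) :
    w * s2 * l / β + β * l / (2 * n * τ) ≤ l * ((Real.sqrt n)⁻¹ * z) := by
  set r := s2 / τ with hr
  have hr0 : 0 < r := div_pos hs hτ
  obtain ⟨hy1, hy2⟩ := abs_le.1 hy
  have he1 : 1 ≤ Real.exp (a / 2) := Real.one_le_exp (le_trans (abs_nonneg _) hy)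
  set N := Real.sqrt n with hN
  have hN0 : 0 < N := Real.sqrt_pos.2 hn
  have hN2 : N ^ 2 = n := Real.sq_sqrt hn.le
  -- `B` is the precision at which the two terms balance. The ratio `β / B` lies in `[1, e^{a/2}]`,
  -- whence `cosh (a/2)`.
  set B := Real.sqrt (2 * n * τ * (w * s2)) with hB
  have hB0 : 0 < B := Real.sqrt_pos.2 (by positivity)
  have hB2 : B ^ 2 = 2 * n * τ * (w * s2) := Real.sq_sqrt (by positivity)
  have hβ0 : 0 < β := by rw [hβ]; positivity
  have hβ2 : β ^ 2 = s2 ^ 2 * (2 * w * n * Real.exp (-(y - a / 2))) := by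
    rw [hβ, mul_pow, Real.sq_sqrt (by positivity)]
  set F := Real.exp (-(y - a / 2)) with hF
  have hsr : r * τ = s2 := by rw [hr]; field_simp
  have hrF : 1 ≤ r * F := by
    rw [hF, ← Real.exp_log hr0, ← Real.exp_add]; exact Real.one_le_exp (by linarith)
  have hrF' : r * F ≤ Real.exp (a / 2) ^ 2 := by
    rw [hF, ← Real.exp_log hr0, ← Real.exp_add, ← Real.exp_nat_mul]
    exact Real.exp_le_exp.2 (by push_cast; linarith)
  have hβB : β ^ 2 = B ^ 2 * (r * F) := by
    rw [hβ2, hB2, ← hsr]; ring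
  have hBβ1 : β ≤ Real.exp (a / 2) * B := by
    refine le_of_sq_le_sq ?_ (by positivity)
    rw [hβB, mul_pow, mul_comm]
    exact mul_le_mul_of_nonneg_right hrF' (sq_nonneg B)
  have hBβ2 : B ≤ Real.exp (a / 2) * β := by
    have h : B ≤ β := by
      refine le_of_sq_le_sq ?_ hβ0.le
      rw [hβB]
      exact le_mul_of_one_le_right (sq_nonneg B) hrF
    exact h.trans (le_mul_of_one_le_left hβ0.le he1)
  have hc2 := sq_add_sq_le_mul_cosh hBβ1 hBβ2
  have e1 : N⁻¹ * Real.sqrt (2 * w * s2 / τ) = B / (n * τ) := by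
    have h1 : Real.sqrt (2 * w * s2 / τ) = B / (N * τ) := by
      rw [Real.sqrt_eq_iff_mul_self_eq_of_pos (by positivity), ← sq, div_pow, hB2, mul_pow, hN2]
      field_simp
    rw [h1, ← hN2]; field_simp
  have e2 : w * s2 * l / β + β * l / (2 * n * τ) =
      l * ((β ^ 2 + B ^ 2) / (2 * n * τ * β)) := by
    rw [hB2]; field_simp; ring
  rw [e2, hz, ← mul_assoc N⁻¹, e1]
  apply mul_le_mul_of_nonneg_left _ hl0.le
  rw [div_le_iff₀ (by positivity)]
  have : B / (n * τ) * Real.cosh (a / 2) * (2 * n * τ * β) = 2 * β * B * Real.cosh (a / 2) := by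
    field_simp
  rw [this]; exact hc2

/-! ### The function `ζ` -/

section Zeta

variable {n : ℕ} {a ε κ s2 : ℝ}

theorem zeta_nonneg (t : ℝ) : 0 ≤ zeta n a ε κ s2 t :=
  add_nonneg (mul_nonneg (Real.sqrt_nonneg _) (Real.cosh_pos _).le)
    (mul_nonneg (Real.sqrt_nonneg _) (Real.cosh_pos _).le)

theorem zeta_antitone (hκ : 1 < κ) (hs : 0 < s2) {s t : ℝ} (h0 : 0 < s) (h : s ≤ t) :
    zeta n a ε κ s2 t ≤ zeta n a ε κ s2 s := by
  have hc := cst_nonneg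
  have hk : 0 < Real.sqrt κ := Real.sqrt_pos.2 (by linarith)
  have hκ' : 0 ≤ κ - 1 := by linarith
  have h1 := (Real.cosh_pos (a / 4)).le
  have h2 := (Real.cosh_pos (a / 2)).le
  unfold zeta
  gcongr

theorem sqrt_mul_zeta_le (hκ : 1 < κ) (hs : 0 < s2)
    (hL : 0 < Real.log ((numScales n a κ : ℝ) / ε)) {s t : ℝ} (h0 : 0 < s) (h : s ≤ t) :
    Real.sqrt s * zeta n a ε κ s2 s ≤ Real.sqrt t * zeta n a ε κ s2 t := by
  have hc := cst_nonneg
  have hk : 0 < Real.sqrt κ := Real.sqrt_pos.2 (by linarith)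
  have hκ' : 0 ≤ κ - 1 := by linarith
  have key : ∀ u : ℝ, 0 < u → Real.sqrt u * zeta n a ε κ s2 u =
      Real.sqrt (2 * (κ - 1) * ((2 + 3 * cst) * s2 / (4 * (2 + cst) * Real.sqrt κ)
        + u * Real.log ((numScales n a κ : ℝ) / ε))) * Real.cosh (a / 4)
      + Real.sqrt (2 * (2 + cst) * Real.sqrt κ * s2) * Real.cosh (a / 2) := by
    intro u hu
    unfold zeta
    rw [mul_add, ← mul_assoc, ← mul_assoc, ← Real.sqrt_mul hu.le, ← Real.sqrt_mul hu.le]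
    congr 2
    · congr 1; field_simp
    · congr 1; field_simp
  rw [key s h0, key t (h0.trans_le h)]
  have h1 := (Real.cosh_pos (a / 4)).le
  gcongr

/-- The second term of `ζ` alone gives this. The right-hand side is the quantity whose logarithm
defines the number of scales, so the grid reaches every scale needed. -/
theorem scale_bound_of_zeta_le (hκ : 1 < κ) (hs : 0 < s2) {σ : ℝ} (hσ : 0 < σ)
    (hζ : 8 * zeta n a ε κ s2 σ ≤ Real.sqrt n) :
    s2 / σ ≤ n / (72 * (2 + cst) * Real.sqrt κ) := by
  have hc := cst_nonneg
  have hk : 0 < Real.sqrt κ := Real.sqrt_pos.2 (by linarith)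
  set Q := 2 * (2 + cst) * Real.sqrt κ * s2 / σ with hQ
  have hQ0 : 0 < Q := by positivity
  have h1 : Real.sqrt Q ≤ zeta n a ε κ s2 σ := by
    have h2 := mul_nonneg (Real.sqrt_nonneg (2 * (κ - 1) *
      ((2 + 3 * cst) * s2 / (4 * (2 + cst) * Real.sqrt κ * σ)
        + Real.log ((numScales n a κ : ℝ) / ε)))) (Real.cosh_pos (a / 4)).le
    have h3 := mul_le_mul_of_nonneg_left (Real.one_le_cosh (a / 2)) (Real.sqrt_nonneg Q)
    unfold zeta
    linarith
  have h2 : 8 * Real.sqrt Q ≤ Real.sqrt n := by linarith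
  have h3 : (8 * Real.sqrt Q) ^ 2 ≤ Real.sqrt n ^ 2 := pow_le_pow_left₀ (by positivity) h2 2
  rw [mul_pow, Real.sq_sqrt hQ0.le, Real.sq_sqrt (Nat.cast_nonneg n)] at h3
  rw [le_div_iff₀ (by positivity)]
  have e : s2 / σ * (72 * (2 + cst) * Real.sqrt κ) = 36 * Q := by rw [hQ]; ring
  rw [e]; linarith

theorem exists_scale (ha : 0 < a) (hκ : 1 < κ) (hs : 0 < s2) {σ τ : ℝ} (hσ : 0 < σ)
    (hζ : 8 * zeta n a ε κ s2 σ ≤ Real.sqrt n) (h1 : σ ≤ τ) (h2 : τ ≤ s2) :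
    ∃ j < numScales n a κ, |j * a - Real.log (s2 / τ)| ≤ a / 2 := by
  have hτ : 0 < τ := hσ.trans_le h1
  set y := Real.log (s2 / τ) with hy
  have hy0 : 0 ≤ y := Real.log_nonneg (by rw [le_div_iff₀ hτ]; linarith)
  have hyle : y ≤ Real.log (n / (72 * (2 + cst) * Real.sqrt κ)) := by
    apply Real.log_le_log (by positivity)
    exact le_trans (by gcongr) (scale_bound_of_zeta_le hκ hs hσ hζ)
  have hpos : 0 ≤ y / a + 1 / 2 := by positivity
  have hf1 := Nat.floor_le hpos
  have hf2 := Nat.lt_floor_add_one (y / a + 1 / 2)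
  -- The integer nearest to `y / a`. Rounding adds at most `1/2`, less than the extra `1` in
  -- `numScales`.
  refine ⟨⌊y / a + 1 / 2⌋₊, ?_, ?_⟩
  · unfold numScales
    have h3 : y / a ≤ a⁻¹ * Real.log (n / (72 * (2 + cst) * Real.sqrt κ)) := by
      rw [div_eq_inv_mul]; gcongr
    have h4 := Nat.le_ceil (a⁻¹ * Real.log (n / (72 * (2 + cst) * Real.sqrt κ)))
    have h5 : (⌊y / a + 1 / 2⌋₊ : ℝ) <
        ((1 + ⌈a⁻¹ * Real.log (n / (72 * (2 + cst) * Real.sqrt κ))⌉₊ : ℕ) : ℝ) := by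
      push_cast; linarith
    exact_mod_cast h5
  · have e : y / a * a = y := by field_simp
    rw [abs_le]
    constructor <;> nlinarith

theorem level_precision_bound (hn : 0 < n) (hκ : 1 < κ) (hs : 0 < s2)
    (hL : 0 < Real.log ((numScales n a κ : ℝ) / ε)) {τ : ℝ} (hτ : 0 < τ) {j : ℕ}
    (hj : |j * a - Real.log (s2 / τ)| ≤ a / 2) :
    0 < level n a ε κ j ∧
    (κ - 1) * level n a ε κ j ^ 2 / 2
      + (2 + cst) * Real.sqrt κ * s2 * level n a ε κ j / precision n a κ s2 j
      + (2 + 3 * cst) * s2 ^ 2 / (2 * precision n a κ s2 j ^ 2)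
      + precision n a κ s2 j * level n a ε κ j / (2 * n * τ)
      + Real.log ((numScales n a κ : ℝ) / ε) / n ≤
        level n a ε κ j * ((Real.sqrt n)⁻¹ * zeta n a ε κ s2 τ) ∧
    level n a ε κ j * (κ - 1) ≤ 2 * ((Real.sqrt n)⁻¹ * zeta n a ε κ s2 τ) := by
  have hc := cst_nonneg
  have hn' : (0 : ℝ) < n := by exact_mod_cast hn
  have hk : 0 < Real.sqrt κ := Real.sqrt_pos.2 (by linarith)
  set l := level n a ε κ j with hl
  set β := precision n a κ s2 j with hβ
  have hl' : l = Real.sqrt (2 / (n * (κ - 1)) * ((2 + 3 * cst) / (4 * ((2 + cst) * Real.sqrt κ))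
      * Real.exp (j * a) + Real.log ((numScales n a κ : ℝ) / ε))) := by
    rw [hl, level, ← mul_assoc 4]
  have hβ' : β = s2 * Real.sqrt (2 * ((2 + cst) * Real.sqrt κ) * n
      * Real.exp (-(j * a - a / 2))) := by
    rw [hβ, precision, ← mul_assoc 2]
    congr 4
    ring
  obtain ⟨h1, h2, h3⟩ := variance_terms_le hn' hκ (w := (2 + cst) * Real.sqrt κ) (by positivity)
    (g := 2 + 3 * cst) (by positivity) hL hs hτ hj hl' hβ' rfl
  have h4 := precision_terms_le hn' (w := (2 + cst) * Real.sqrt κ) (by positivity) hs hτ hj h1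
    hβ' rfl
  have e : zeta n a ε κ s2 τ = Real.sqrt (2 * (κ - 1) * ((2 + 3 * cst) * s2 /
      (4 * ((2 + cst) * Real.sqrt κ) * τ) + Real.log ((numScales n a κ : ℝ) / ε)))
        * Real.cosh (a / 4)
      + Real.sqrt (2 * ((2 + cst) * Real.sqrt κ) * s2 / τ) * Real.cosh (a / 2) := by
    rw [zeta, ← mul_assoc 4, ← mul_assoc 2 (2 + cst)]
  have h5 : 0 ≤ (Real.sqrt n)⁻¹ * (Real.sqrt (2 * ((2 + cst) * Real.sqrt κ) * s2 / τ)
      * Real.cosh (a / 2)) := by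
    have := (Real.cosh_pos (a / 2)).le
    positivity
  refine ⟨h1, ?_, ?_⟩ <;> rw [e, mul_add (Real.sqrt n)⁻¹]
  · rw [mul_add l]; linarith
  · linarith

end Zeta

/-! ### Comparison of two points of the confidence region -/

/-- Two values of the same confidence region are close to each other. -/
theorem sub_le_of_mem_confidenceRegion {d n : ℕ} {a ε κ s2 σ : ℝ} (hn : 0 < n) (ha : 0 < a)
    (hκ : 3 / 2 ≤ κ) (hs : 0 < s2) (hσ : 0 < σ)
    (hL : 0 < Real.log ((numScales n a κ : ℝ) / ε))
    (hζ : 8 * zeta n a ε κ s2 σ ≤ Real.sqrt n) {x : Fin n → EuclideanSpace ℝ (Fin d)}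
    {θ : EuclideanSpace ℝ (Fin d)} (hθ : ‖θ‖ = 1) {p q : ℝ}
    (hp : p ∈ confidenceRegion a ε κ s2 x θ) (hq : q ∈ confidenceRegion a ε κ s2 x θ)
    (hpq : p ≤ q) {τ : ℝ} (h1 : σ ≤ τ) (h2 : τ ≤ s2) (h3 : τ ≤ q) :
    (q - p) * (1 - 2 * ((Real.sqrt n)⁻¹ * zeta n a ε κ s2 τ)) ≤
      q * (2 * ((Real.sqrt n)⁻¹ * zeta n a ε κ s2 τ)) := by
  obtain ⟨j, hjK, hj⟩ := exists_scale ha (by linarith) hs hσ hζ h1 h2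
  have hτ : 0 < τ := hσ.trans_le h1
  have hq0 : 0 < q := hτ.trans_le h3
  have hn' : (0 : ℝ) < n := by exact_mod_cast hn
  obtain ⟨hl0, hD, hlb⟩ := level_precision_bound (κ := κ) hn (by linarith) hs hL hτ hj
  have hβ0 := precision_pos hn a (show 0 < κ by linarith) hs j
  -- With `α² = l / q`, the value `q` becomes exactly `l`, so `(N - l)²` vanishes in its deviation
  -- bound.
  have hp' := hp.2 j hjK (Real.sqrt (level n a ε κ j / q)) (Real.sqrt_nonneg _)
  have hq' := hq.2 j hjK (Real.sqrt (level n a ε κ j / q)) (Real.sqrt_nonneg _)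
  set l := level n a ε κ j
  set β := precision n a κ s2 j
  set b := (Real.sqrt n)⁻¹ * zeta n a ε κ s2 τ with hb
  have hb0 : 0 ≤ b := mul_nonneg (by positivity) (zeta_nonneg _)
  have hα : Real.sqrt (l / q) ^ 2 = l / q := Real.sq_sqrt (by positivity)
  have hnorm : ‖Real.sqrt (l / q) • θ‖ ^ 2 = l / q := by
    rw [norm_smul, hθ, mul_one, Real.norm_of_nonneg (Real.sqrt_nonneg _), hα]
  have eq1 : l / q * q = l := by field_simp
  rw [hα] at hp' hq'
  rw [eq1] at hq'
  set y := l / q * p with hy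
  have hy0 : 0 ≤ y := mul_nonneg (by positivity) hp.1
  have hyl : y ≤ l := by
    rw [← eq1, hy]; gcongr
  have hβq : β * (l / q) / (2 * n) ≤ β * l / (2 * n * τ) := by
    have : β * (l / q) / (2 * n) = β * l / (2 * n * q) := by field_simp
    rw [this]; gcongr
  have hDq : deviation n a ε κ s2 l β l (Real.sqrt (l / q) • θ) ≤ l * b := by
    unfold deviation
    rw [hnorm]
    have : ((l - l) ^ 2 + (κ - 1) * l ^ 2) / 2 = (κ - 1) * l ^ 2 / 2 := by ring
    rw [this]; linarith
  have hDp : deviation n a ε κ s2 l β y (Real.sqrt (l / q) • θ) ≤ (y - l) ^ 2 / 2 + l * b := by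
    refine le_trans ?_ (add_le_add_right hDq ((y - l) ^ 2 / 2))
    unfold deviation
    have h4 : (κ - 1) * y ^ 2 ≤ (κ - 1) * l ^ 2 :=
      mul_le_mul_of_nonneg_left (pow_le_pow_left₀ hy0 hyl 2) (by linarith)
    have h5 : (2 + cst) * Real.sqrt κ * s2 * y / β ≤ (2 + cst) * Real.sqrt κ * s2 * l / β := by
      have := cst_nonneg
      gcongr
    have e0 : (l - l) ^ 2 = 0 := by ring
    rw [e0]
    linarith
  -- Both constraints bound the same criterion, which is eliminated by the triangle inequality.
  have hmain : l - y ≤ 2 * (l * b) + (y - l) ^ 2 / 2 := by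
    have k1 := (abs_le.1 (hp'.trans hDp)).2
    have k2 := (abs_le.1 (hq'.trans hDq)).1
    have k3 := (abs_le.1 (hp'.trans hDp)).1
    have k4 := (abs_le.1 (hq'.trans hDq)).2
    linarith
  -- Here `κ ≥ 3/2` turns `l (κ - 1) ≤ 2 b` into `l ≤ 4 b`. With `X ≤ 1`, the quadratic term below
  -- is then at most `2 b X` and moves to the left-hand side.
  have hl4 : l ≤ 4 * b := by
    have := mul_le_mul_of_nonneg_left (show 1 / 2 ≤ κ - 1 by linarith) hl0.le
    linarith
  set X := (q - p) / q with hX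
  have hX0 : 0 ≤ X := div_nonneg (by linarith) hq0.le
  have hX1 : X ≤ 1 := by rw [hX, div_le_one hq0]; linarith [hp.1]
  have eX : l - y = l * X := by rw [hy, hX]; field_simp
  have eX2 : (y - l) ^ 2 = (l * X) ^ 2 := by rw [← eX]; ring
  rw [eX, eX2] at hmain
  have hX2 : X ≤ 2 * b + l * X ^ 2 / 2 := by
    have : l * X ≤ l * (2 * b + l * X ^ 2 / 2) := by linarith
    exact le_of_mul_le_mul_left this hl0
  have hX3 : l * X ^ 2 ≤ 4 * b * X := by
    have h6 : X ^ 2 ≤ X := by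
      rw [sq]; exact mul_le_of_le_one_left hX0 hX1
    calc l * X ^ 2 ≤ 4 * b * X ^ 2 := by gcongr
      _ ≤ 4 * b * X := by gcongr
  have hX4 : X * (1 - 2 * b) ≤ 2 * b := by linarith
  have e3 : q * X = q - p := by rw [hX]; field_simp
  have := mul_le_mul_of_nonneg_left hX4 hq0.le
  rw [← e3]; linarith

/-- The error bound `2 max(t, σ) b / (1 - 4 b)`, with `b` evaluated at `t` truncated to
`[σ, s]`. -/
def errorBound (b : ℝ → ℝ) (s σ t : ℝ) : ℝ :=
  2 * max t σ * (b (max (min t s) σ) / (1 - 4 * b (max (min t s) σ)))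

/-! ### Monotonicity and growth of the error bound -/

section ErrorBound

variable {b : ℝ → ℝ} {s σ : ℝ}

theorem ratio_le_ratio {u v : ℝ} (huv : u ≤ v) (hv : v ≤ 1 / 8) :
    u / (1 - 4 * u) ≤ v / (1 - 4 * v) := by
  rw [div_le_div_iff₀ (by linarith) (by linarith)]; linarith

/-- With `r = √(t/u)` and `v = b t`, the hypothesis gives `b u ≥ r v`. The claim reduces to `(1 -
r)(1 - 4v(1 + r)) ≥ 0`, true since `v ≤ 1/8`. -/
theorem mul_ratio_mono (hσ : 0 < σ) (hb0 : ∀ t, σ ≤ t → 0 ≤ b t) (hb8 : ∀ t, σ ≤ t → b t ≤ 1 / 8)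
    (hsq : ∀ t u, σ ≤ t → t ≤ u → Real.sqrt t * b t ≤ Real.sqrt u * b u)
    {t u : ℝ} (ht : σ ≤ t) (htu : t ≤ u) :
    t * (b t / (1 - 4 * b t)) ≤ u * (b u / (1 - 4 * b u)) := by
  have ht0 : 0 < t := hσ.trans_le ht
  have hu0 : 0 < u := ht0.trans_le htu
  set x := Real.sqrt t with hx
  set y := Real.sqrt u with hy
  have hx0 : 0 < x := Real.sqrt_pos.2 ht0
  have hy0 : 0 < y := Real.sqrt_pos.2 hu0
  have hx2 : x ^ 2 = t := Real.sq_sqrt ht0.le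
  have hy2 : y ^ 2 = u := Real.sq_sqrt hu0.le
  have hxy : x ≤ y := Real.sqrt_le_sqrt htu
  have h1 := hb8 t ht
  have h2 := hb0 t ht
  have h3 : x / y * b t ≤ b u := by
    rw [div_mul_eq_mul_div, div_le_iff₀ hy0]; linarith [hsq t u ht htu]
  have h4 := ratio_le_ratio h3 (hb8 u (ht.trans htu))
  refine le_trans ?_ (mul_le_mul_of_nonneg_left h4 hu0.le)
  set r := x / y with hr
  have hr0 : 0 < r := div_pos hx0 hy0
  have hr1 : r ≤ 1 := by rw [hr, div_le_one hy0]; exact hxy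
  have et : t = r ^ 2 * u := by rw [hr, ← hx2, ← hy2]; field_simp
  generalize b t = v at *
  rw [et, mul_assoc, mul_comm (r ^ 2), mul_assoc]
  apply mul_le_mul_of_nonneg_left _ hu0.le
  have hrb : r * v ≤ 1 / 8 := by nlinarith
  rw [div_mul_eq_mul_div, div_le_div_iff₀ (by linarith) (by linarith)]
  have h5 : 0 ≤ (1 - r) * (1 - 4 * v * (1 + r)) := mul_nonneg (by linarith) (by nlinarith)
  have h6 : 0 ≤ r * v := mul_nonneg hr0.le h2
  nlinarith [mul_nonneg h6 h5]

theorem max_min_eq (hs : σ ≤ s) (t : ℝ) : max (min t s) σ = min (max t σ) s := by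
  rcases le_total t s with h1 | h1 <;> rcases le_total t σ with h2 | h2 <;> simp [*]
  all_goals linarith

theorem errorBound_nonneg (hσ : 0 < σ) (hb0 : ∀ t, σ ≤ t → 0 ≤ b t)
    (hb8 : ∀ t, σ ≤ t → b t ≤ 1 / 8) (t : ℝ) : 0 ≤ errorBound b s σ t := by
  have h := le_max_right (min t s) σ
  have := hb8 _ h
  exact mul_nonneg (by have := le_max_right t σ; linarith)
    (div_nonneg (hb0 _ h) (by linarith))

/-- Up to `s` this is `mul_ratio_mono`; beyond `s` the argument of `b` is frozen and the bound is
linear. -/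
theorem errorBound_mono (hσ : 0 < σ) (hs : σ ≤ s) (hb0 : ∀ t, σ ≤ t → 0 ≤ b t)
    (hb8 : ∀ t, σ ≤ t → b t ≤ 1 / 8)
    (hsq : ∀ t u, σ ≤ t → t ≤ u → Real.sqrt t * b t ≤ Real.sqrt u * b u) :
    Monotone (errorBound b s σ) := by
  intro t u htu
  unfold errorBound
  rw [max_min_eq hs, max_min_eq hs]
  have h1 : σ ≤ max t σ := le_max_right _ _
  have h2 : max t σ ≤ max u σ := max_le_max htu le_rfl
  set T := max t σ
  set U := max u σ
  have hm := @mul_ratio_mono b σ hσ hb0 hb8 hsq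
  have hs0 : 0 ≤ b s / (1 - 4 * b s) := div_nonneg (hb0 s hs) (by linarith [hb8 s hs])
  rw [mul_assoc, mul_assoc]
  apply mul_le_mul_of_nonneg_left _ zero_le_two
  rcases le_total U s with hU | hU
  · rw [min_eq_left hU, min_eq_left (h2.trans hU)]
    exact hm h1 h2
  · rw [min_eq_right hU]
    rcases le_total T s with hT | hT
    · rw [min_eq_left hT]
      exact (hm h1 hT).trans (by gcongr)
    · rw [min_eq_right hT]
      gcongr

/-- The ratio `b / (1 - 4b)` does not increase with `t` and is at most `1/4`, so the bound grows at
rate at most `2 · 1/4`. -/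
theorem errorBound_add_le (hσ : 0 < σ) (hb8 : ∀ t, σ ≤ t → b t ≤ 1 / 8)
    (hb0 : ∀ t, σ ≤ t → 0 ≤ b t) (hanti : ∀ t u, σ ≤ t → t ≤ u → b u ≤ b t) (t : ℝ) {h : ℝ}
    (hh : 0 ≤ h) : errorBound b s σ (t + h) ≤ errorBound b s σ t + h / 2 := by
  unfold errorBound
  have h1 : σ ≤ max (min t s) σ := le_max_right _ _
  have h2 : max (min t s) σ ≤ max (min (t + h) s) σ :=
    max_le_max (min_le_min (by linarith) le_rfl) le_rfl
  have h3 := ratio_le_ratio (hanti _ _ h1 h2) (hb8 _ h1)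
  have h4 := ratio_le_ratio (hb8 _ h1) le_rfl
  norm_num at h4
  set β := b (max (min t s) σ) / (1 - 4 * b (max (min t s) σ))
  have hβ0 : 0 ≤ β := div_nonneg (hb0 _ h1) (by linarith [hb8 _ h1])
  have h5 : max (t + h) σ ≤ max t σ + h :=
    max_le (by linarith [le_max_left t σ]) (by linarith [le_max_right t σ])
  have h6 : 0 ≤ max (t + h) σ := by linarith [le_max_right (t + h) σ]
  calc _ ≤ 2 * max (t + h) σ * β := by gcongr
    _ ≤ 2 * (max t σ + h) * β := by gcongr
    _ ≤ 2 * max t σ * β + h / 2 := by nlinarith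

end ErrorBound

/-- The scale always comes from `p`. If `q ≤ p`, the comparison is already relative to `p`. If `p ≤
q`, it is relative to `q = p + (q - p)`, and moving `q - p` to the left turns `1 - 2b` into `1 -
4b`. -/
theorem abs_max_sub_max_le_errorBound {d n : ℕ} {a ε κ s2 σ : ℝ} (hn : 0 < n) (ha : 0 < a)
    (hκ : 3 / 2 ≤ κ) (hs : σ ≤ s2) (hσ : 0 < σ)
    (hL : 0 < Real.log ((numScales n a κ : ℝ) / ε))
    (hζ : 8 * zeta n a ε κ s2 σ ≤ Real.sqrt n) {x : Fin n → EuclideanSpace ℝ (Fin d)}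
    {θ : EuclideanSpace ℝ (Fin d)} (hθ : ‖θ‖ = 1) {p q : ℝ}
    (hp : p ∈ confidenceRegion a ε κ s2 x θ) (hq : q ∈ confidenceRegion a ε κ s2 x θ)
    (hpq : min p q ≤ s2) (hb8 : ∀ t, σ ≤ t → (Real.sqrt n)⁻¹ * zeta n a ε κ s2 t ≤ 1 / 8) :
    |max p σ - max q σ| ≤ errorBound (fun t => (Real.sqrt n)⁻¹ * zeta n a ε κ s2 t) s2 σ p := by
  have hs0 : 0 < s2 := hσ.trans_le hs
  have hb0 : ∀ t, σ ≤ t → 0 ≤ (Real.sqrt n)⁻¹ * zeta n a ε κ s2 t := fun t _ =>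
    mul_nonneg (by positivity) (zeta_nonneg _)
  have hF0 := errorBound_nonneg (s := s2) hσ hb0 hb8 p
  rcases le_total q p with h | h
  · rw [abs_of_nonneg (sub_nonneg.2 (max_le_max h le_rfl))]
    rcases le_or_gt p σ with hpσ | hpσ
    · rw [max_eq_right hpσ, max_eq_right (h.trans hpσ), sub_self]
      exact hF0
    · have hτ : σ ≤ min p s2 := le_min hpσ.le hs
      have key := sub_le_of_mem_confidenceRegion hn ha hκ hs0 hσ hL hζ hθ hq hp h hτ
        (min_le_right _ _) (min_le_left _ _)
      have h8 := hb8 _ hτ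
      have h0 := hb0 _ hτ
      unfold errorBound
      rw [max_eq_left hτ, max_eq_left hpσ.le]
      set b := (Real.sqrt n)⁻¹ * zeta n a ε κ s2 (min p s2)
      have hp0 : 0 < p := hσ.trans hpσ
      refine le_trans (sub_le_sub_left (le_max_left q σ) p) ?_
      rw [mul_div_assoc', le_div_iff₀ (by linarith)]
      nlinarith [mul_nonneg h0 (sub_nonneg.2 h)]
  · rw [abs_sub_comm, abs_of_nonneg (sub_nonneg.2 (max_le_max h le_rfl))]
    rcases le_or_gt q σ with hqσ | hqσ
    · rw [max_eq_right hqσ, max_eq_right (h.trans hqσ), sub_self]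
      exact hF0
    · rw [min_eq_left h] at hpq
      have hτ : σ ≤ max p σ := le_max_right _ _
      have key := sub_le_of_mem_confidenceRegion hn ha hκ hs0 hσ hL hζ hθ hp hq h hτ
        (max_le hpq hs) (max_le h hqσ.le)
      have h8 := hb8 _ hτ
      have h0 := hb0 _ hτ
      unfold errorBound
      rw [min_eq_left hpq, max_eq_left hqσ.le]
      set b := (Real.sqrt n)⁻¹ * zeta n a ε κ s2 (max p σ)
      have hpm := le_max_left p σ
      set t := max p σ
      rw [mul_div_assoc', le_div_iff₀ (by linarith)]
      nlinarith [mul_nonneg h0 (sub_nonneg.2 hpm)]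

/-! ### Quadratic forms and eigenvalues -/

section Eigenvalues

variable {d : ℕ}

theorem quadForm_eq_inner (M : Matrix (Fin d) (Fin d) ℝ) (θ : EuclideanSpace ℝ (Fin d)) :
    quadForm M θ = inner ℝ θ (Matrix.toEuclideanLin M θ) := by
  simp only [quadForm, PiLp.inner_apply, Matrix.toLpLin_apply, Matrix.mulVec, dotProduct,
    Finset.sum_mul, RCLike.inner_apply, conj_trivial]
  refine Finset.sum_congr rfl fun i _ => Finset.sum_congr rfl fun j _ => ?_
  ring

theorem sortedEigenvalues_antitone {M : Matrix (Fin d) (Fin d) ℝ} (hM : M.IsHermitian) :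
    Antitone (sortedEigenvalues hM) := fun i j hij =>
  hM.eigenvalues₀_antitone (by simpa using hij)

/-- An orthonormal basis in which a symmetric matrix is diagonal, with non-increasing diagonal. -/
theorem exists_basis_quadForm {M : Matrix (Fin d) (Fin d) ℝ} (hM : M.IsHermitian) :
    ∃ b : OrthonormalBasis (Fin d) ℝ (EuclideanSpace ℝ (Fin d)), ∀ θ,
      quadForm M θ = ∑ k, sortedEigenvalues hM k * (inner ℝ (b k) θ) ^ 2 := by
  let e : Fin d ≃ Fin d := (finCongr (Fintype.card_fin d).symm).trans
    (Fintype.equivOfCardEq (Fintype.card_fin (Fintype.card (Fin d))))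
  have he : ∀ k, hM.eigenvalues (e k) = sortedEigenvalues hM k := by
    intro k
    simp [Matrix.IsHermitian.eigenvalues, sortedEigenvalues, e]
  refine ⟨hM.eigenvectorBasis.reindex e.symm, fun θ => ?_⟩
  set b := hM.eigenvectorBasis.reindex e.symm with hb
  have hbk : ∀ k, Matrix.toEuclideanLin M (b k) = sortedEigenvalues hM k • b k := by
    intro k
    have : b k = hM.eigenvectorBasis (e k) := by simp [hb]
    rw [this, ← he]
    ext i
    have := congrFun (hM.mulVec_eigenvectorBasis (e k)) i
    simpa [Matrix.toLpLin_apply] using this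
  rw [quadForm_eq_inner]
  conv_lhs => rw [← b.sum_repr' θ]
  rw [b.sum_repr' θ]
  conv_lhs =>
    arg 3
    rw [← b.sum_repr' θ, map_sum]
  rw [inner_sum]
  refine Finset.sum_congr rfl fun k _ => ?_
  rw [map_smul, hbk, inner_smul_right, inner_smul_right, real_inner_comm]
  ring

/-- Courant–Fischer with a single vector: orthogonality to the eigenvectors of `M` before `i` and to
those of `M'` after `i` is only `d - 1` linear conditions. -/
theorem exists_unit_quadForm_le_le {M M' : Matrix (Fin d) (Fin d) ℝ} (hM : M.IsHermitian)
    (hM' : M'.IsHermitian) (i : Fin d) : ∃ θ : EuclideanSpace ℝ (Fin d), ‖θ‖ = 1 ∧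
      quadForm M θ ≤ sortedEigenvalues hM i ∧ sortedEigenvalues hM' i ≤ quadForm M' θ := by
  obtain ⟨b, hb⟩ := exists_basis_quadForm hM
  obtain ⟨b', hb'⟩ := exists_basis_quadForm hM'
  let f : EuclideanSpace ℝ (Fin d) →ₗ[ℝ] ({k : Fin d // k ≠ i} → ℝ) :=
    LinearMap.pi fun k => if k.1 < i then (innerₛₗ ℝ (b k.1)) else (innerₛₗ ℝ (b' k.1))
  have hrank : Module.finrank ℝ ({k : Fin d // k ≠ i} → ℝ) <
      Module.finrank ℝ (EuclideanSpace ℝ (Fin d)) := by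
    rw [Module.finrank_fintype_fun_eq_card, finrank_euclideanSpace, Fintype.card_fin]
    have := Fintype.card_subtype_lt (p := fun k : Fin d => k ≠ i) (x := i) (by simp)
    simpa using this
  obtain ⟨θ₀, hθ₀, hne⟩ := Submodule.exists_mem_ne_zero_of_ne_bot
    (LinearMap.ker_ne_bot_of_finrank_lt (f := f) hrank)
  have hn0 : 0 < ‖θ₀‖ := norm_pos_iff.2 hne
  set θ := ‖θ₀‖⁻¹ • θ₀ with hθ
  have hfθ : ∀ k : {k : Fin d // k ≠ i}, f θ k = 0 := by
    intro k
    rw [hθ, map_smul, LinearMap.mem_ker.1 hθ₀]; simp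
  have h1 : ∀ k, k < i → inner ℝ (b k) θ = 0 := by
    intro k hk
    have := hfθ ⟨k, hk.ne⟩
    simpa [f, hk] using this
  have h2 : ∀ k, i < k → inner ℝ (b' k) θ = 0 := by
    intro k hk
    have := hfθ ⟨k, hk.ne'⟩
    simpa [f, hk.le.not_gt] using this
  have hnorm : ‖θ‖ = 1 := by
    rw [hθ, norm_smul, norm_inv, norm_norm, inv_mul_cancel₀ hn0.ne']
  have hsq : ∀ c : OrthonormalBasis (Fin d) ℝ (EuclideanSpace ℝ (Fin d)),
      ∑ k, inner ℝ (c k) θ ^ 2 = 1 := fun c => by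
    rw [c.sum_sq_inner_right, hnorm, one_pow]
  refine ⟨θ, hnorm, ?_, ?_⟩
  · rw [hb, ← mul_one (sortedEigenvalues hM i), ← hsq b, Finset.mul_sum]
    refine Finset.sum_le_sum fun k _ => ?_
    rcases lt_or_ge k i with hk | hk
    · rw [h1 k hk]; simp
    · exact mul_le_mul_of_nonneg_right (sortedEigenvalues_antitone hM hk) (sq_nonneg _)
  · rw [hb', ← mul_one (sortedEigenvalues hM' i), ← hsq b', Finset.mul_sum]
    refine Finset.sum_le_sum fun k _ => ?_
    rcases lt_or_ge i k with hk | hk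
    · rw [h2 k hk]; simp
    · exact mul_le_mul_of_nonneg_right (sortedEigenvalues_antitone hM' hk) (sq_nonneg _)

theorem frobenius_sq (M : Matrix (Fin d) (Fin d) ℝ) :
    frobenius M ^ 2 = ∑ i, ∑ j, M i j ^ 2 := by
  have h : (Mᵀ * M).trace = ∑ i, ∑ j, M i j ^ 2 := by
    rw [Finset.sum_comm]
    simp [Matrix.trace, Matrix.mul_apply, sq]
  rw [frobenius, h]
  exact Real.sq_sqrt (Finset.sum_nonneg fun i _ => Finset.sum_nonneg fun j _ => sq_nonneg _)

theorem abs_apply_le_frobenius (M : Matrix (Fin d) (Fin d) ℝ) (i j : Fin d) :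
    |M i j| ≤ frobenius M := by
  refine abs_le_of_sq_le_sq ?_ (Real.sqrt_nonneg _)
  rw [frobenius_sq]
  exact (Finset.single_le_sum (f := fun j => M i j ^ 2) (fun j _ => sq_nonneg _)
    (Finset.mem_univ j)).trans (Finset.single_le_sum (f := fun i => ∑ j, M i j ^ 2)
      (fun i _ => Finset.sum_nonneg fun j _ => sq_nonneg _) (Finset.mem_univ i))

theorem abs_bilin_le (M : Matrix (Fin d) (Fin d) ℝ) (u w : EuclideanSpace ℝ (Fin d)) :
    |∑ i, ∑ j, u i * M i j * w j| ≤ ‖u‖ * ‖w‖ * frobenius M := by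
  have h0 : 0 ≤ frobenius M := Real.sqrt_nonneg _
  refine abs_le_of_sq_le_sq ?_ (by positivity)
  have h := Finset.sum_mul_sq_le_sq_mul_sq (Finset.univ : Finset (Fin d × Fin d))
    (fun p => u p.1 * w p.2) (fun p => M p.1 p.2)
  rw [mul_pow, mul_pow, frobenius_sq, EuclideanSpace.real_norm_sq_eq,
    EuclideanSpace.real_norm_sq_eq, Finset.sum_mul_sum]
  simp only [Fintype.sum_prod_type, mul_pow] at h
  refine le_trans (le_of_eq ?_) h
  congr 1
  refine Finset.sum_congr rfl fun i _ => Finset.sum_congr rfl fun j _ => ?_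
  ring

/-- By symmetry the difference is `(θ - ξ)ᵀ M (θ + ξ)`, and `‖θ + ξ‖ ≤ 2`. -/
theorem abs_quadForm_sub_le {M : Matrix (Fin d) (Fin d) ℝ} (hM : M.IsHermitian)
    {θ ξ : EuclideanSpace ℝ (Fin d)} (hθ : ‖θ‖ = 1) (hξ : ‖ξ‖ = 1) :
    |quadForm M θ - quadForm M ξ| ≤ 2 * ‖θ - ξ‖ * frobenius M := by
  have hsymm : ∀ i j, M i j = M j i := fun i j => by simpa using (hM.apply i j).symm
  have hcomm : ∑ i, ∑ j, θ i * M i j * ξ j = ∑ i, ∑ j, ξ i * M i j * θ j := by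
    rw [Finset.sum_comm]
    refine Finset.sum_congr rfl fun i _ => Finset.sum_congr rfl fun j _ => ?_
    rw [hsymm j i]; ring
  have e : quadForm M θ - quadForm M ξ = ∑ i, ∑ j, (θ - ξ) i * M i j * (θ + ξ) j := by
    have : ∀ i j, (θ - ξ) i * M i j * (θ + ξ) j = θ i * M i j * θ j + θ i * M i j * ξ j
        - ξ i * M i j * θ j - ξ i * M i j * ξ j := fun i j => by simp; ring
    simp_rw [this, Finset.sum_sub_distrib, Finset.sum_add_distrib, hcomm, quadForm]
    ring
  have h0 : 0 ≤ frobenius M := Real.sqrt_nonneg _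
  have h2 : ‖θ + ξ‖ ≤ 2 := (norm_add_le _ _).trans (by rw [hθ, hξ]; norm_num)
  rw [e]
  refine (abs_bilin_le M _ _).trans ?_
  have : ‖θ - ξ‖ * ‖θ + ξ‖ ≤ 2 * ‖θ - ξ‖ := by nlinarith [norm_nonneg (θ - ξ)]
  gcongr

/-- Comparison of the eigenvalues of two symmetric matrices whose quadratic forms are close to each
other on a net of the sphere. -/
theorem abs_max_eigenvalue_sub_le {M M' : Matrix (Fin d) (Fin d) ℝ} (hM : M.IsHermitian)
    (hM' : M'.IsHermitian) {F : ℝ → ℝ} {σ δ R : ℝ} (hF : Monotone F)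
    (hF0 : ∀ t, 0 ≤ F t)    (hFadd : ∀ t h, 0 ≤ h → F (t + h) ≤ F t + h / 2)
    {T : Finset (EuclideanSpace ℝ (Fin d))} (hT : IsSphereNet δ T)
    (hMR : frobenius M ≤ R) (hMR' : frobenius M' ≤ R)
    (hclose : ∀ ξ ∈ T, |max (quadForm M ξ) σ - max (quadForm M' ξ) σ| ≤ F (quadForm M ξ))
    (i : Fin d) :
    |max (sortedEigenvalues hM i) σ - max (sortedEigenvalues hM' i) σ| ≤
      F (sortedEigenvalues hM i) + 5 * δ * R := by
  have hR : 0 ≤ R := (Real.sqrt_nonneg _).trans hMR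
  have hnet : ∀ θ : EuclideanSpace ℝ (Fin d), ‖θ‖ = 1 → 0 ≤ δ ∧ ∃ ξ ∈ T,
      |quadForm M θ - quadForm M ξ| ≤ 2 * δ * R ∧ |quadForm M' θ - quadForm M' ξ| ≤ 2 * δ * R := by
    intro θ hθ
    obtain ⟨ξ, hξT, hξ⟩ := hT.2 θ hθ
    have hδ : 0 ≤ δ := (norm_nonneg _).trans hξ
    refine ⟨hδ, ξ, hξT, (abs_quadForm_sub_le hM hθ (hT.1 ξ hξT)).trans ?_,
      (abs_quadForm_sub_le hM' hθ (hT.1 ξ hξT)).trans ?_⟩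
    · have h0 : 0 ≤ frobenius M := Real.sqrt_nonneg _
      gcongr
    · have h0 : 0 ≤ frobenius M' := Real.sqrt_nonneg _
      gcongr
  have hmax : ∀ s t h : ℝ, 0 ≤ h → s ≤ t + h → max s σ ≤ max t σ + h := fun s t h hh hst =>
    max_le (by linarith [le_max_left t σ]) (by linarith [le_max_right t σ])
  set lam := sortedEigenvalues hM i
  set lam' := sortedEigenvalues hM' i
  rw [abs_le]
  constructor
  -- The five `δ R` are `2 + 2` for moving the two forms to the net and `1` for the growth of `F`
  -- over `2 δ R`.
  · obtain ⟨θ, hθ, h1, h2⟩ := exists_unit_quadForm_le_le hM hM' i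
    obtain ⟨hδ, ξ, hξ, h3, h4⟩ := hnet θ hθ
    have hh : 0 ≤ 2 * δ * R := by positivity
    have h5 := (abs_le.1 (hclose ξ hξ)).1
    have h6 : F (quadForm M ξ) ≤ F (lam + 2 * δ * R) := hF (by linarith [(abs_le.1 h3).1])
    have h7 := hFadd lam _ hh
    have h8 := hmax (quadForm M ξ) lam _ hh (by linarith [(abs_le.1 h3).1])
    have h9 := hmax lam' (quadForm M' ξ) _ hh (by linarith [(abs_le.1 h4).2])
    linarith
  · obtain ⟨θ, hθ, h1, h2⟩ := exists_unit_quadForm_le_le hM' hM i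
    obtain ⟨hδ, ξ, hξ, h3, h4⟩ := hnet θ hθ
    have hh : 0 ≤ 2 * δ * R := by positivity
    have h5 := (abs_le.1 (hclose ξ hξ)).2
    have h9 := hmax (quadForm M' ξ) lam' _ hh (by linarith [(abs_le.1 h4).1])
    rcases le_total (quadForm M ξ) lam with h | h
    · have h6 := hF h
      have h8 := hmax lam (quadForm M ξ) _ hh (by linarith [(abs_le.1 h3).2])
      have : 0 ≤ δ * R := by positivity
      linarith
    -- When the form at `ξ` exceeds `lam`, `F` grows at half the rate of the form, so the excess is
    -- absorbed on the left.
    · have h7 := hFadd lam (quadForm M ξ - lam) (by linarith)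
      rw [add_sub_cancel] at h7
      rcases le_total lam σ with hσ | hσ
      · rw [max_eq_right hσ]
        have h8 := hF0 lam
        have : 0 ≤ δ * R := by positivity
        linarith [le_max_right lam' σ]
      · rw [max_eq_left (hσ.trans h)] at h5
        rw [max_eq_left hσ]
        have : 0 ≤ δ * R := by positivity
        linarith

/-- The functional calculus gives the roots of the characteristic polynomial; since `t ↦ t⁺` is
nondecreasing, the list stays sorted. -/
theorem sortedEigenvalues_posPart {M : Matrix (Fin d) (Fin d) ℝ} (hM : M.IsHermitian)
    (hM' : (M⁺).IsHermitian) (i : Fin d) :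
    sortedEigenvalues hM' i = max (sortedEigenvalues hM i) 0 := by
  have hcfc : M⁺ = cfc (fun t : ℝ => t⁺) M := by
    rw [CFC.posPart_def, cfcₙ_eq_cfc]
  have hchar : (M⁺).charpoly.roots =
      Multiset.map (fun k => (hM.eigenvalues₀ k)⁺) Finset.univ.val := by
    rw [hcfc, hM.charpoly_cfc_eq, Polynomial.roots_prod _ _
      (Finset.prod_ne_zero_iff.2 fun k _ => Polynomial.X_sub_C_ne_zero _)]
    simp only [RCLike.ofReal_real_eq_id, id, Polynomial.roots_X_sub_C, Multiset.bind_singleton]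
    have h1 := hM.roots_charpoly_eq_eigenvalues
    rw [hM.roots_charpoly_eq_eigenvalues₀] at h1
    have h2 := congrArg (Multiset.map fun t : ℝ => t⁺) h1
    simp only [Multiset.map_map] at h2
    exact h2.symm
  have hlist : List.ofFn hM'.eigenvalues₀ = List.ofFn fun k => (hM.eigenvalues₀ k)⁺ := by
    rw [← hM'.sort_roots_charpoly_eq_eigenvalues₀, hchar]
    simp_rw [Fin.univ_val_map, Multiset.map_coe, List.map_ofFn, Multiset.coe_sort]
    apply List.mergeSort_of_pairwise
    simp_rw [decide_eq_true_eq, ← List.sortedGE_iff_pairwise]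
    have hanti : Antitone fun k => (hM.eigenvalues₀ k)⁺ := fun k l hkl =>
      posPart_mono (hM.eigenvalues₀_antitone hkl)
    exact hanti.sortedGE_ofFn
  have := congrFun (List.ofFn_injective hlist) (Fin.cast (Fintype.card_fin d).symm i)
  unfold sortedEigenvalues
  rw [this]; rfl

end Eigenvalues

/-! ### Existence of the estimator -/

section Existence

variable {d n : ℕ} {a ε κ s2 : ℝ} {x : Fin n → EuclideanSpace ℝ (Fin d)}

theorem isClosed_confidenceRegion (θ : EuclideanSpace ℝ (Fin d)) :
    IsClosed (confidenceRegion a ε κ s2 x θ) := by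
  have : confidenceRegion a ε κ s2 x θ = Set.Ici 0 ∩ ⋂ j : ℕ, ⋂ _ : j < numScales n a κ,
      ⋂ α : ℝ, ⋂ _ : 0 ≤ α, {t | |criterion x (level n a ε κ j) (α • θ)
        - (α ^ 2 * t - level n a ε κ j)| ≤ deviation n a ε κ s2 (level n a ε κ j)
          (precision n a κ s2 j) (α ^ 2 * t) (α • θ)} := by
    ext t; simp [confidenceRegion]
  rw [this]
  refine isClosed_Ici.inter (isClosed_iInter fun j => isClosed_iInter fun _ =>
    isClosed_iInter fun α => isClosed_iInter fun _ => ?_)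
  unfold deviation
  exact isClosed_le (by fun_prop) (by fun_prop)

theorem continuous_frobenius : Continuous (frobenius (d := d)) := by
  unfold frobenius
  fun_prop

theorem continuous_quadForm (θ : EuclideanSpace ℝ (Fin d)) :
    Continuous fun M : Matrix (Fin d) (Fin d) ℝ => quadForm M θ := by
  unfold quadForm
  fun_prop

theorem isClosed_feasible (T : Finset (EuclideanSpace ℝ (Fin d))) :
    IsClosed (feasible a ε κ s2 T x) := by
  have : feasible a ε κ s2 T x = {M | Mᵀ = M} ∩ ⋂ θ ∈ T,
      (fun M => quadForm M θ) ⁻¹' (confidenceRegion a ε κ s2 x θ) := by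
    ext M; simp [feasible, Matrix.IsSymm]
  rw [this]
  refine (isClosed_eq (by fun_prop) (by fun_prop)).inter
    (isClosed_biInter fun θ _ => (isClosed_confidenceRegion θ).preimage (continuous_quadForm θ))

/-- Minimise over the feasible matrices of norm at most that of `M`: a closed subset of a box in the
entries, hence compact. -/
theorem isSolution_estimatorQ {T : Finset (EuclideanSpace ℝ (Fin d))}
    {M : Matrix (Fin d) (Fin d) ℝ} (hM : M ∈ feasible a ε κ s2 T x) :
    IsSolution a ε κ s2 T x (estimatorQ a ε κ s2 T x) := by
  have hex : ∃ Q, IsSolution a ε κ s2 T x Q := by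
    set S := feasible a ε κ s2 T x ∩ {Q | frobenius Q ≤ frobenius M}
    have hcomp : IsCompact S := by
      have hbox : IsCompact (Set.univ.pi fun _ : Fin d => Set.univ.pi fun _ : Fin d =>
          Set.Icc (-frobenius M) (frobenius M)) :=
        isCompact_univ_pi fun _ => isCompact_univ_pi fun _ => isCompact_Icc
      refine IsCompact.of_isClosed_subset (s := (Set.univ.pi fun _ : Fin d =>
        Set.univ.pi fun _ : Fin d => Set.Icc (-frobenius M) (frobenius M) :
          Set (Matrix (Fin d) (Fin d) ℝ))) hbox
        ((isClosed_feasible T).inter (isClosed_le continuous_frobenius continuous_const)) ?_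
      intro Q hQ i _ j _
      exact abs_le.1 ((abs_apply_le_frobenius Q i j).trans hQ.2)
    obtain ⟨Q, hQ, hmin⟩ := hcomp.exists_isMinOn ⟨M, hM, le_refl (frobenius M)⟩
      continuous_frobenius.continuousOn
    refine ⟨Q, hQ.1, fun Q' hQ' => ?_⟩
    rcases le_total (frobenius Q') (frobenius M) with h | h
    · exact hmin ⟨hQ', h⟩
    · exact le_trans hQ.2 h
  unfold estimatorQ
  rw [dif_pos hex]
  exact hex.choose_spec

end Existence

/-! ### The bound of the proposition -/

/-- Since `κ ≥ 3/2`, `6 + (κ - 1)⁻¹ ≤ 8`, so the finite branch of `BStar` is the one in force. -/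
theorem coe_le_mul_BStar_add {n : ℕ} {a ε κ s2 σ t m v r : ℝ} (hκ : 3 / 2 ≤ κ)
    (h8 : 8 * zeta n a ε κ s2 (max t σ) ≤ Real.sqrt n)
    (h : v ≤ 2 * m * ((Real.sqrt n)⁻¹ * zeta n a ε κ s2 (max t σ) /
      (1 - 4 * ((Real.sqrt n)⁻¹ * zeta n a ε κ s2 (max t σ)))) + r) :
    ((v : ℝ) : EReal) ≤ ((2 * m : ℝ) : EReal) * BStar n a ε κ s2 σ t + ((r : ℝ) : EReal) := by
  have hcond : (6 + (κ - 1)⁻¹) * zeta n a ε κ s2 (max t σ) ≤ Real.sqrt n := by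
    have h1 : (κ - 1)⁻¹ ≤ 2 := by
      rw [inv_le_comm₀ (by linarith) (by norm_num)]; linarith
    exact le_trans (mul_le_mul_of_nonneg_right (by linarith) (zeta_nonneg _)) h8
  unfold BStar
  rw [if_pos hcond, ← EReal.coe_mul, ← EReal.coe_add, EReal.coe_le_coe_iff, mul_assoc 4]
  linarith

theorem max_max_zero {σ : ℝ} (hσ : 0 < σ) (t : ℝ) : max (max t 0) σ = max t σ := by
  rw [max_assoc, max_eq_right hσ.le]

theorem abs_sub_le_of_nonneg {s t σ : ℝ} (hs : 0 ≤ s) (ht : 0 ≤ t) (hσ : 0 < σ) :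
    |s - t| ≤ |max s σ - max t σ| + σ := by
  rcases le_total s σ with h1 | h1 <;>
    rcases le_total t σ with h2 | h2 <;> simp only [h1, h2, max_eq_left, max_eq_right] <;>
    rw [abs_le] <;> constructor <;>
    first
      | linarith [abs_nonneg (σ - σ)]
      | linarith [le_abs_self (σ - t), neg_abs_le (σ - t)]
      | linarith [le_abs_self (s - σ), neg_abs_le (s - σ)]
      | linarith [le_abs_self (s - t), neg_abs_le (s - t)]

theorem sortedEigenvalues_gram_mem {d : ℕ} {P : Measure (EuclideanSpace ℝ (Fin d))}
    [IsProbabilityMeasure P] (hP : Integrable (fun x => ‖x‖ ^ 4) P) (i : Fin d) :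
    0 ≤ sortedEigenvalues (gram_isHermitian P) i ∧
      sortedEigenvalues (gram_isHermitian P) i ≤ sFourSq P := by
  obtain ⟨θ, hθ, h1, h2⟩ := exists_unit_quadForm_le_le (gram_isHermitian P) (gram_isHermitian P) i
  exact ⟨(quadForm_gram_nonneg hP θ).trans h1, h2.trans (quadForm_gram_le hP hθ)⟩

/-- Comparison of the eigenvalues of the Gram matrix and of the estimator, on the event where the
Gram matrix satisfies the constraints. -/
theorem abs_max_eigenvalue_sub_estimator_le {d n : ℕ} {P : Measure (EuclideanSpace ℝ (Fin d))}
    [IsProbabilityMeasure P] (hP : Integrable (fun x => ‖x‖ ^ 4) P) (hn : 0 < n) {a ε δ σ : ℝ}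
    (ha : 0 < a) (hσ : 0 < σ) (hσs : σ ≤ sFourSq P) (hκ : 3 / 2 ≤ kurtosis P)
    (hL : 0 < Real.log ((numScales n a (kurtosis P) : ℝ) / ε))
    (hζ : 8 * zeta n a ε (kurtosis P) (sFourSq P) σ ≤ Real.sqrt n)
    {T : Finset (EuclideanSpace ℝ (Fin d))} (hT : IsSphereNet δ T)
    {x : Fin n → EuclideanSpace ℝ (Fin d)}
    (hx : ∀ θ, quadForm (gram P) θ ∈ confidenceRegion a ε (kurtosis P) (sFourSq P) x θ)
    (i : Fin d) {lam lamHat : ℝ} (hlam : lam = sortedEigenvalues (gram_isHermitian P) i)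
    (hlamHat : lamHat = sortedEigenvalues
      (estimator_isHermitian a ε (kurtosis P) (sFourSq P) T x) i) :
    0 ≤ lamHat ∧
    |max lam σ - max lamHat σ| ≤
      errorBound (fun t => (Real.sqrt n)⁻¹ * zeta n a ε (kurtosis P) (sFourSq P) t)
        (sFourSq P) σ lam + 5 * δ * frobenius (gram P) ∧
    |max lam σ - max lamHat σ| ≤
      errorBound (fun t => (Real.sqrt n)⁻¹ * zeta n a ε (kurtosis P) (sFourSq P) t)
        (sFourSq P) σ lamHat + 5 * δ * frobenius (gram P) := by
  set κ := kurtosis P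
  set s2 := sFourSq P
  set b : ℝ → ℝ := fun t => (Real.sqrt n)⁻¹ * zeta n a ε κ s2 t with hb
  have hs0 : 0 < s2 := hσ.trans_le hσs
  have hn' : 0 < Real.sqrt n := Real.sqrt_pos.2 (by exact_mod_cast hn)
  have hb0 : ∀ t, σ ≤ t → 0 ≤ b t := fun t _ => mul_nonneg (by positivity) (zeta_nonneg _)
  have hanti : ∀ t u, σ ≤ t → t ≤ u → b u ≤ b t := fun t u ht htu =>
    mul_le_mul_of_nonneg_left (zeta_antitone (by linarith) hs0 (hσ.trans_le ht) htu)
      (by positivity)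
  have hb8 : ∀ t, σ ≤ t → b t ≤ 1 / 8 := fun t ht => by
    refine (hanti σ t le_rfl ht).trans ?_
    simp only [hb]
    rw [inv_mul_le_iff₀ hn']; linarith
  have hsq : ∀ t u, σ ≤ t → t ≤ u → Real.sqrt t * b t ≤ Real.sqrt u * b u := fun t u ht htu => by
    have h := sqrt_mul_zeta_le (n := n) (a := a) (ε := ε) (κ := κ) (by linarith) hs0 hL
      (hσ.trans_le ht) htu
    have h' := mul_le_mul_of_nonneg_left h (inv_nonneg.2 hn'.le)
    simp only [hb]
    linarith
  -- `G` itself competes, so a minimiser exists and its Frobenius norm is at most that of `G`.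
  have hGfeas : gram P ∈ feasible a ε κ s2 T x :=
    ⟨by simpa [Matrix.IsSymm, Matrix.IsHermitian] using gram_isHermitian P, fun θ _ => hx θ⟩
  obtain ⟨hQ, hQmin⟩ := isSolution_estimatorQ hGfeas
  set Q := estimatorQ a ε κ s2 T x with hQdef
  have hQh : Q.IsHermitian := by
    simpa [Matrix.IsSymm, Matrix.IsHermitian] using hQ.1
  have hF0 := errorBound_nonneg (b := b) (s := s2) hσ hb0 hb8
  have hF := errorBound_mono (b := b) hσ hσs hb0 hb8 hsq
  have hFadd : ∀ t h, 0 ≤ h → errorBound b s2 σ (t + h) ≤ errorBound b s2 σ t + h / 2 :=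
    fun t h hh => errorBound_add_le hσ hb8 hb0 hanti t hh
  have hle : ∀ ξ ∈ T, quadForm (gram P) ξ ≤ s2 := fun ξ hξ => quadForm_gram_le hP (hT.1 ξ hξ)
  have h1 := abs_max_eigenvalue_sub_le (gram_isHermitian P) hQh hF hF0 hFadd hT le_rfl
    (hQmin _ hGfeas) (σ := σ) (fun ξ hξ => abs_max_sub_max_le_errorBound hn ha hκ hσs hσ hL hζ
      (hT.1 ξ hξ) (hx ξ) (hQ.2 ξ hξ) ((min_le_left _ _).trans (hle ξ hξ)) hb8) i
  -- The same comparison with the roles exchanged. The form of `Q` may exceed `s₄²`, but only the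
  -- smaller of the two values has to stay below it.
  have h2 := abs_max_eigenvalue_sub_le hQh (gram_isHermitian P) hF hF0 hFadd hT
    (hQmin _ hGfeas) le_rfl (σ := σ) (fun ξ hξ => abs_max_sub_max_le_errorBound hn ha hκ hσs hσ hL
      hζ (hT.1 ξ hξ) (hQ.2 ξ hξ) (hx ξ) ((min_le_right _ _).trans (hle ξ hξ)) hb8) i
  have hpos : lamHat = max (sortedEigenvalues hQh i) 0 := by
    rw [hlamHat]; exact sortedEigenvalues_posPart hQh _ i
  rw [← hlam] at h1 h2
  have hmax : max lamHat σ = max (sortedEigenvalues hQh i) σ := by rw [hpos, max_max_zero hσ]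
  refine ⟨by rw [hpos]; exact le_max_right _ _, by rw [hmax]; exact h1, ?_⟩
  have he : errorBound b s2 σ lamHat = errorBound b s2 σ (sortedEigenvalues hQh i) := by
    unfold errorBound
    rw [max_min_eq hσs, max_min_eq hσs, hmax]
  rw [he, hmax, abs_sub_comm]
  exact h2

end RobustGram

end

/-! ### Proof of the proposition -/

theorem proposition3p1 {Ω : Type*} [MeasurableSpace Ω] (μ : Measure Ω) [IsProbabilityMeasure μ]
    {d n : ℕ}
    -- the law of the data, with a finite moment of order four
    (P : Measure (EuclideanSpace ℝ (Fin d))) [IsProbabilityMeasure P]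
    (hP : Integrable (fun x => ‖x‖ ^ 4) P)
    -- the i.i.d. sample
    (X : Fin n → Ω → EuclideanSpace ℝ (Fin d))
    (hX : ∀ i, Measurable (X i)) (hindep : iIndepFun X μ) (hlaw : ∀ i, μ.map (X i) = P)
    -- the parameters
    (a ε δ σ : ℝ) (ha : 0 < a) (hε : 0 < ε) (hσ : 0 < σ)
    (T : Finset (EuclideanSpace ℝ (Fin d))) (hT : RobustGram.IsSphereNet δ T)
    -- the assumptions of the proposition
    (hζ : 8 * RobustGram.zeta n a ε (RobustGram.kurtosis P) (RobustGram.sFourSq P) σ ≤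
      Real.sqrt n)
    (hσs : σ ≤ RobustGram.sFourSq P)
    (hκ : 3 / 2 ≤ RobustGram.kurtosis P) :
    ∃ A : Set Ω, MeasurableSet A ∧ 1 - 2 * ε ≤ μ.real A ∧
      ∀ ω ∈ A, ∀ i : Fin d, ∀ lam lamHat : ℝ,
        lam = RobustGram.sortedEigenvalues (RobustGram.gram_isHermitian P) i →
        lamHat = RobustGram.sortedEigenvalues
          (RobustGram.estimator_isHermitian a ε (RobustGram.kurtosis P) (RobustGram.sFourSq P) T
            (fun k => X k ω)) i →
        ((|max lam σ - max lamHat σ| : ℝ) : EReal) ≤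
            ((2 * max lam σ : ℝ) : EReal) *
              RobustGram.BStar n a ε (RobustGram.kurtosis P) (RobustGram.sFourSq P) σ lam
            + ((5 * δ * RobustGram.frobenius (RobustGram.gram P) : ℝ) : EReal) ∧
        ((|max lam σ - max lamHat σ| : ℝ) : EReal) ≤
            ((2 * max lamHat σ : ℝ) : EReal) *
              RobustGram.BStar n a ε (RobustGram.kurtosis P) (RobustGram.sFourSq P) σ
                (min lamHat (RobustGram.sFourSq P))
            + ((5 * δ * RobustGram.frobenius (RobustGram.gram P) : ℝ) : EReal) ∧
        ((|lam - lamHat| : ℝ) : EReal) ≤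
            ((2 * max lam σ : ℝ) : EReal) *
              RobustGram.BStar n a ε (RobustGram.kurtosis P) (RobustGram.sFourSq P) σ lam
            + ((5 * δ * RobustGram.frobenius (RobustGram.gram P) + σ : ℝ) : EReal) ∧
        ((|lam - lamHat| : ℝ) : EReal) ≤
            ((2 * max lamHat σ : ℝ) : EReal) *
              RobustGram.BStar n a ε (RobustGram.kurtosis P) (RobustGram.sFourSq P) σ
                (min lamHat (RobustGram.sFourSq P))
            + ((5 * δ * RobustGram.frobenius (RobustGram.gram P) + σ : ℝ) : EReal) := by
  have hs0 : 0 < RobustGram.sFourSq P := hσ.trans_le hσs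
  have hκ0 : 0 < RobustGram.kurtosis P := by linarith
  -- For `ε ≥ 1/2` the empty event is enough; otherwise `K / ε > 1` and the logarithm in `ζ` is
  -- positive.
  rcases le_or_gt (1 / 2) ε with hε2 | hε2
  · exact ⟨∅, MeasurableSet.empty, by simp; linarith, fun ω hω => absurd hω (Set.notMem_empty ω)⟩
  -- For `n = 0` the scale bound would read `s₄² / σ ≤ 0`.
  have hn : 0 < n := by
    rcases Nat.eq_zero_or_pos n with rfl | h
    · have h1 := RobustGram.scale_bound_of_zeta_le (by linarith) hs0 hσ hζ
      have h2 : 0 < RobustGram.sFourSq P / σ := div_pos hs0 hσ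
      simp at h1
      linarith
    · exact h
  have hL : 0 < Real.log ((RobustGram.numScales n a (RobustGram.kurtosis P) : ℝ) / ε) := by
    apply Real.log_pos
    have : (1 : ℝ) ≤ RobustGram.numScales n a (RobustGram.kurtosis P) := by
      exact_mod_cast RobustGram.numScales_pos n a _
    rw [lt_div_iff₀ hε]; linarith
  obtain ⟨A, hA, hAμ, hAx⟩ := RobustGram.exists_deviation_event μ hn hP hκ0 hs0 hX hindep hlaw a hε
  refine ⟨A, hA, hAμ, fun ω hω i lam lamHat hlam hlamHat => ?_⟩
  obtain ⟨hpos, h1, h2⟩ := RobustGram.abs_max_eigenvalue_sub_estimator_le hP hn ha hσ hσs hκ hL hζ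
    hT (hAx ω hω) i hlam hlamHat
  obtain ⟨hlam0, hlams⟩ := RobustGram.sortedEigenvalues_gram_mem hP i
  rw [← hlam] at hlam0 hlams
  have h3 := RobustGram.abs_sub_le_of_nonneg hlam0 hpos hσ
  have h8 : ∀ t, 8 * RobustGram.zeta n a ε (RobustGram.kurtosis P) (RobustGram.sFourSq P)
      (max t σ) ≤ Real.sqrt n := fun t => by
    have := RobustGram.zeta_antitone (n := n) (a := a) (ε := ε)
      (show 1 < RobustGram.kurtosis P by linarith) hs0 hσ (le_max_right t σ)
    linarith
  unfold RobustGram.errorBound at h1 h2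
  -- The eigenvalues of `G` are at most `s₄²`, so the truncation survives only in the bound in terms
  -- of `lamHat`.
  rw [min_eq_left hlams] at h1
  refine ⟨RobustGram.coe_le_mul_BStar_add hκ (h8 _) h1,
    RobustGram.coe_le_mul_BStar_add hκ (h8 _) h2,
    RobustGram.coe_le_mul_BStar_add hκ (h8 _) (r := 5 * δ * RobustGram.frobenius
      (RobustGram.gram P) + σ) ?_,
    RobustGram.coe_le_mul_BStar_add hκ (h8 _) (r := 5 * δ * RobustGram.frobenius
      (RobustGram.gram P) + σ) ?_⟩ <;> linarith
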